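/- **Setting (Bayesian multi-parameter unit-demand mechanism design, BMUMD).** A seller offers a finite set $N$ of services, each targeted at one of finitely many agents; write $N_i\subseteq N$ for the set of services targeted at agent $i$, so that the sets $N_i$ partition $N$. The value of service $e$ for its agent is a random variable $Z_e\ge 0$; the $Z_e$, $e\in N$, are independent with known (arbitrary) distributions. Agents are unit-demand: if the set $T$ of services is provided, then agent $i$ has value $\max_{e\in T\cap N_i} Z_e$ (and $0$ if $T\cap N_i=\varnothing$). The seller may provide any set $T$ of a given family $\mathcal F\subseteq 2^N$. A (randomized, direct) mechanism maps the reported values of all services, measurably, to a lottery over $\mathcal F$ and to expected payments of the agents, which are real numbers; it is truthful if, for every agent and whatever the reports of the others, reporting the true values maximizes the agent's expected utility (value minus payment) and yields a nonnegative expected utility. Its revenue is the expected total payment under truthful reports, and the optimal revenue is the supremum of the revenues of truthful mechanisms. A (constrained oblivious) posted price mechanism on $\mathcal F$ is a pair $(p,\mathcal F')$ with $p\in\mathbb R_{\ge 0}^N$ and $\mathcal F'\subseteq\mathcal F$, which may be chosen at random at the beginning, independently of the valuations. The agents arrive one by one. If $S$ is the set of services sold so far, the arriving agent $i$ is offered every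 service $e\in N_i$ with $S\cup\{e\}\in\mathcal F'$ at price $p_e$; if some offered service satisfies $Z_e\ge p_e$, the agent buys an offered service maximizing $Z_e-p_e$, and otherwise buys nothing. The order of the agents and the breaking of ties between best services are chosen by an adversary who knows all valuations and the realized pair $(p,\mathcal F')$. A matroid constraint on $N$ is the family of independent sets of a matroid on $N$; a knapsack constraint is a family $\{S\subseteq N:\sum_{e\in S}s_e\le B\}$ with sizes $s_e\ge 0$ and capacity $B\ge 0$; a matching constraint is the family of matchings of a loopless (not necessarily bipartite, possibly with parallel edges) graph with edge set $N$. **Corollary.** For every $k\in\mathbb N$ there is a constant $C=C(k)$ such that the following holds. Let $\mathcal F$ be the intersection of $k$ constraints on $N$, each of which is a matroid, a knapsack or a matching constraint. Then for every BMUMD instance on $\mathcal F$ there is a randomized posted price mechanism $(p,\mathcal F')$ on $\mathcal F$ such that $$\text{optimal revenue}\;\le\; C\cdot \mathbb E\big[\text{revenue of }(p,\mathcal F')\text{ against the adversary}\big].$$ -/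

import Mathlib

open MeasureTheory
open scoped NNReal ENNReal

namespace BMUMD

/-! ### Feasibility constraints on a finite ground set -/

/-- The independent sets of a matroid with ground set `N`. -/
def IsMatroidConstraint {N : Type*} (F : Set (Finset N)) : Prop :=
  ∃ M : Matroid N, M.E = Set.univ ∧ F = {S : Finset N | M.Indep (S : Set N)}

/-- The sets whose total size does not exceed a capacity. -/
def IsKnapsackConstraint {N : Type*} (F : Set (Finset N)) : Prop :=
  ∃ (size : N → ℝ≥0) (capacity : ℝ≥0), F = {S : Finset N | ∑ e ∈ S, size e ≤ capacity}

/-- The matchings of a loopless (not necessarily bipartite) graph with edge set `N`, where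
`ends e` is the pair of endpoints of the edge `e`; parallel edges are allowed. -/
def IsMatchingConstraint {N : Type*} (F : Set (Finset N)) : Prop :=
  ∃ (V : Type) (ends : N → Sym2 V), (∀ e, ¬ (ends e).IsDiag) ∧
    F = {S : Finset N | ∀ e ∈ S, ∀ f ∈ S, e ≠ f → ∀ x : V, x ∈ ends e → x ∉ ends f}

/-- `F` is the intersection of `k` matroid, knapsack and matching constraints, in any mix. -/
def IsIntersectionOfConstraints {N : Type*} (k : ℕ) (F : Set (Finset N)) : Prop :=
  ∃ G : Fin k → Set (Finset N),
    (∀ l, IsMatroidConstraint (G l) ∨ IsKnapsackConstraint (G l) ∨ IsMatchingConstraint (G l)) ∧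
    F = ⋂ l, G l

/-! ### Direct mechanisms

`A` is the set of agents, `N` the set of services, `owner j` is the agent at whom the service `j`
is targeted, and `F` is the family of sets of services that the seller may provide. A vector
`v : N → ℝ≥0` lists the values of all services, each for its owner. -/

/-- The value for agent `i` of a set `T` of provided services: an agent wants one service only,
so it is the largest value of a service in `T` targeted at `i`, and `0` if there is none. -/
def unitDemandValue {A N : Type*} [DecidableEq A] (owner : N → A) (i : A) (v : N → ℝ≥0)
    (T : Finset N) : ℝ≥0 :=
  (T.filter (fun j => owner j = i)).sup v

/-- A randomized direct mechanism: the reported values are mapped to a lottery over feasible sets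
of services and to the (expected) payments of the agents. Payments may be negative. -/
structure Mechanism (A : Type*) {N : Type*} (F : Set (Finset N)) where
  alloc : (N → ℝ≥0) → PMF (Finset N)
  payment : (N → ℝ≥0) → A → ℝ
  feasible : ∀ b T, alloc b T ≠ 0 → T ∈ F
  measurable_alloc : ∀ T, Measurable fun b => alloc b T
  measurable_payment : ∀ i, Measurable fun b => payment b i

namespace Mechanism

/-- Expected utility of agent `i` whose true values are the entries of `v` at the services of `i`,
when the reported values of all agents are `b`. -/
noncomputable def utility {A N : Type*} [DecidableEq A] [Fintype N]
    {F : Set (Finset N)} (M : Mechanism A F) (owner : N → A) (i : A) (v b : N → ℝ≥0) : ℝ :=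
  (∑ T : Finset N, (M.alloc b T).toReal * (unitDemandValue owner i v T : ℝ)) - M.payment b i

/-- Reporting the true values is a dominant strategy of every agent (whatever the reports of the
other agents are), and gives every truthful agent a nonnegative utility. -/
def IsTruthful {A N : Type*} [DecidableEq A] [Fintype N]
    {F : Set (Finset N)} (M : Mechanism A F) (owner : N → A) : Prop :=
  (∀ (i : A) (v b : N → ℝ≥0), (∀ j, owner j ≠ i → b j = v j) →
      M.utility owner i v b ≤ M.utility owner i v v) ∧
    ∀ (i : A) (v : N → ℝ≥0), 0 ≤ M.utility owner i v v

/-- Expected total payment when the values (and reports) are independent, the value of service `j`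
having law `D j`. It is the extended real number `E[X⁺] - E[X⁻]`, `X` being the total payment;
an undefined expectation `∞ - ∞` counts as `-∞`. -/
noncomputable def revenue {A N : Type*} [Fintype A] [Fintype N]
    {F : Set (Finset N)} (M : Mechanism A F) (D : N → Measure ℝ≥0) : EReal :=
  ((∫⁻ v, ENNReal.ofReal (∑ i, M.payment v i) ∂(Measure.pi D) : ℝ≥0∞) : EReal) -
    ((∫⁻ v, ENNReal.ofReal (-∑ i, M.payment v i) ∂(Measure.pi D) : ℝ≥0∞) : EReal)

end Mechanism

/-- The supremum of the revenues of the truthful mechanisms. -/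
noncomputable def optimalRevenue {A N : Type*} [Fintype A] [DecidableEq A] [Fintype N]
    (owner : N → A) (F : Set (Finset N)) (D : N → Measure ℝ≥0) : EReal :=
  ⨆ (M : Mechanism A F) (_ : M.IsTruthful owner), M.revenue D

/-! ### Constrained oblivious posted price mechanisms -/

/-- Take-it-or-leave-it prices, and a subfamily of the feasible family in which the set of sold
services has to stay. -/
structure PostedPricing {N : Type*} (F : Set (Finset N)) where
  price : N → ℝ≥0
  allowed : Set (Finset N)
  allowed_subset : allowed ⊆ F

namespace PostedPricing

/-- If the set `S` of services is already sold, then agent `i`, upon arrival, is offered those of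
its services that can be added to `S` within the restricted family. -/
def Offers {A N : Type*} [DecidableEq N] {F : Set (Finset N)} (m : PostedPricing F)
    (owner : N → A) (S : Finset N) (i : A) (j : N) : Prop :=
  owner j = i ∧ insert j S ∈ m.allowed

/-- `m.Run owner v l S T`: if the services in `S` are sold already and the agents in the list `l`
arrive in this order, then `T` may be the set of services sold in the end. An arriving agent buys
an offered service of largest value minus price, provided that some offered service has a value of
at least its price; otherwise it buys nothing. Ties between best services may be broken in any
way. -/
inductive Run {A N : Type*} [DecidableEq N] {F : Set (Finset N)} (m : PostedPricing F)
    (owner : N → A) (v : N → ℝ≥0) : List A → Finset N → Finset N → Prop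
  | done (S : Finset N) : Run m owner v [] S S
  | skip (i : A) (l : List A) (S T : Finset N)
      (hskip : ∀ j, m.Offers owner S i j → v j < m.price j)
      (hrest : Run m owner v l S T) : Run m owner v (i :: l) S T
  | buy (i : A) (l : List A) (S T : Finset N) (j : N)
      (hoffer : m.Offers owner S i j) (haccept : m.price j ≤ v j)
      (hbest : ∀ k, m.Offers owner S i k →
        (v k : ℝ) - (m.price k : ℝ) ≤ (v j : ℝ) - (m.price j : ℝ))
      (hrest : Run m owner v l (insert j S) T) : Run m owner v (i :: l) S T

/-- The revenue at the valuation `v` against an adversary who knows `v`, the prices and the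
restricted family, and chooses the order of arrival of the agents and the breaking of ties. -/
noncomputable def worstCaseRevenue {A N : Type*} [DecidableEq N]
    {F : Set (Finset N)} (m : PostedPricing F) (owner : N → A) (v : N → ℝ≥0) : ℝ≥0∞ :=
  ⨅ (l : List A) (T : Finset N) (_ : l.Nodup ∧ ∀ i, i ∈ l) (_ : m.Run owner v l ∅ T),
    ∑ j ∈ T, (m.price j : ℝ≥0∞)

end PostedPricing

/-- Expected revenue of the randomized posted price mechanism that draws its prices and restricted
family from `μ` at the beginning, independently of the valuations; the adversary also knows the
outcome of this draw. -/
noncomputable def postedRevenue {A N : Type*} [DecidableEq N] [Fintype N]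
    {F : Set (Finset N)} (μ : PMF (PostedPricing F)) (owner : N → A) (D : N → Measure ℝ≥0) :
    ℝ≥0∞ :=
  ∑' m : PostedPricing F, μ m * ∫⁻ v, m.worstCaseRevenue owner v ∂(Measure.pi D)

end BMUMD

/-!
The two sides are compared with the linear program of single services. For a truthful mechanism
`M`, let `q e` be the probability that the service `e` is provided and is the one its owner uses,
and let `W e` be the supremum over prices `p` of `p * min (D e [p, ∞)) (q e)`.

Upper bound (`Mechanism.IsTruthful.lintegral_payment_le`): the revenue of `M` is at most
`6 * ∑ e, W e`, up to an arbitrarily small error. With the thresholds `β e = W e / q e`, the service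
of an agent with the largest `v e - β e > 0` is its favorite, and the payment of the agent is at
most the sum of three parts (`Mechanism.IsTruthful.payment_le`).
* The payment for the favorite: by truthfulness `useProb` is a subgradient of the utility, so this
  is the payment of a monotone allocation rule for a single service. Such a rule is decomposed into
  posted prices growing geometrically (`lintegral_payment_le`).
* The thresholds of the services used, which contribute `β e * q e = W e`.
* The second largest excess `v e - β e`, which is dominated by the revenue of offering each service
  at its threshold plus the largest excess of its rivals.
All terms are nonnegative, so no integrability is needed.

Lower bound (`sum_price_mul_min_le`): for all prices, `∑ e, p e * min (D e [p e, ∞)) (q e)` is at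
most a constant, depending on `k` only, times the supremum of the revenues of posted price
mechanisms. Independent coins switch services off so that `e` is active (switched on, and of value
at least `p e`) with a small multiple of the probability `min (D e [p e, ∞)) (q e)`. Since `q` lies
in the relaxation of each constraint, there are subfamilies in which a service is unlikely to be
blocked by *any* feasible set of other active services (`Resolvable`). For a matroid this is the
chain construction of `exists_family_of_rank`, for a matching constraint a union bound, and for a
knapsack constraint Markov's inequality after separating big services from small ones. A service
that is active, not blocked, and the only active one of its owner is sold whatever the adversary
does. A union bound shows that this has conditional probability at least `1 / 2`. The average over
the coins, and the `2 ^ k` combinations of big and small, are absorbed by the supremum.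

Finally a discrete mixture of posted price mechanisms attains half of the supremum, also when the
supremum is infinite (`exists_pmf_iSup_le`).
-/

namespace BMUMD

/-! ### Laws of random sets -/

/-- Probability of the event `E` for a random subset of `N` whose law has the point masses `w`. -/
noncomputable def prob {N : Type*} [Fintype N] (w : Finset N → ℝ) (E : Set (Finset N)) : ℝ :=
  ∑ S, E.indicator w S

section RandomSet

variable {N : Type*} [Fintype N] {w : Finset N → ℝ}

lemma prob_mono (hw : ∀ S, 0 ≤ w S) {E E' : Set (Finset N)} (h : E ⊆ E') :
    prob w E ≤ prob w E' :=
  Finset.sum_le_sum fun S _ => Set.indicator_le_indicator_of_subset h hw S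

lemma prob_le_sum_mul (hw : ∀ S, 0 ≤ w S) {E : Set (Finset N)} {g : Finset N → ℝ}
    (hg : ∀ S, 0 ≤ g S) (hE : ∀ S ∈ E, 1 ≤ g S) : prob w E ≤ ∑ S, w S * g S := by
  refine Finset.sum_le_sum fun S _ => ?_
  by_cases hS : S ∈ E
  · rw [Set.indicator_of_mem hS]
    exact le_mul_of_one_le_right (hw S) (hE S hS)
  · rw [Set.indicator_of_notMem hS]
    exact mul_nonneg (hw S) (hg S)

lemma sum_mul_sum_mem (a : N → ℝ) :
    ∑ S, w S * ∑ f ∈ S, a f = ∑ f, a f * prob w {S | f ∈ S} := by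
  classical
  have h1 : ∀ S : Finset N, w S * ∑ f ∈ S, a f = ∑ f, a f * Set.indicator {S | f ∈ S} w S := by
    intro S
    rw [Finset.mul_sum, ← Finset.sum_filter_add_sum_filter_not Finset.univ (fun f => f ∈ S)]
    rw [Finset.sum_eq_zero (s := Finset.univ.filter fun f => f ∉ S), add_zero]
    · rw [Finset.filter_mem_eq_inter, Finset.univ_inter]
      refine Finset.sum_congr rfl fun f hf => ?_
      rw [Set.indicator_of_mem (by exact hf), mul_comm]
    · intro f hf
      rw [Set.indicator_of_notMem (by simpa using hf), mul_zero]
  simp_rw [h1, prob, Finset.mul_sum]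
  exact Finset.sum_comm

end RandomSet

/-! ### Contention resolution for a single constraint -/

/-- `q` satisfies every linear inequality with nonnegative coefficients that is valid for the
indicator vectors of the sets in `G`. -/
def InRelaxation {N : Type*} [Fintype N] (G : Set (Finset N)) (q : N → ℝ) : Prop :=
  ∀ (a : N → ℝ) (c : ℝ), (∀ f, 0 ≤ a f) → (∀ T ∈ G, ∑ f ∈ T, a f ≤ c) → ∑ f, a f * q f ≤ c

lemma InRelaxation.mono {N : Type*} [Fintype N] {G G' : Set (Finset N)} {q : N → ℝ}
    (h : InRelaxation G q) (hG : G ⊆ G') : InRelaxation G' q :=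
  fun a c ha hT => h a c ha fun T hTG => hT T (hG hTG)

/-- The service `e` cannot be added to some set of the family `F'` that may have been sold when
the other services of `S` could be sold. -/
def Blocks {N : Type*} [DecidableEq N] (F' : Set (Finset N)) (e : N) (S : Finset N) : Prop :=
  ∃ I ⊆ S.erase e, I ∈ F' ∧ insert e I ∉ F'

/-- The rank function of a matroid on a finite type, on finsets and with natural number values. -/
lemma exists_rank {N : Type*} [DecidableEq N] (M : Matroid N) : ∃ r : Finset N → ℕ,
    (∀ S : Finset N, M.Indep S ↔ r S = S.card) ∧ Monotone r ∧
    (∀ S T, r (S ∪ T) + r (S ∩ T) ≤ r S + r T) ∧ ∀ S, r S ≤ S.card := by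
  have hfin : ∀ S : Finset N, ∃ n : ℕ, M.eRk S = n := fun S =>
    (ENat.ne_top_iff_exists.1 (ne_top_of_le_ne_top (by simp) (M.eRk_le_encard (S : Set N)))).imp
      fun _ h => h.symm
  choose r hr using hfin
  refine ⟨r, fun S => ?_, fun S T h => ?_, fun S T => ?_, fun S => ?_⟩
  · rw [Matroid.indep_iff_eRk_eq_encard_of_finite S.finite_toSet, Set.encard_coe_eq_coe_finsetCard,
      hr S]
    norm_cast
  · have := M.eRk_mono (Finset.coe_subset.2 h)
    rw [hr, hr] at this
    exact_mod_cast this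
  · have := M.eRk_inter_add_eRk_union_le (S : Set N) (T : Set N)
    rw [← Finset.coe_inter, ← Finset.coe_union, hr, hr, hr S, hr T, add_comm] at this
    exact_mod_cast this
  · have := M.eRk_le_encard (S : Set N)
    rw [Set.encard_coe_eq_coe_finsetCard, hr] at this
    exact_mod_cast this

section Resolution

variable {N : Type*} [Fintype N] {w : Finset N → ℝ} {q : N → ℝ} {β : ℝ}
  {G : Set (Finset N)}

lemma prob_le_of_sum_mul_le (hw : ∀ S, 0 ≤ w S) (hβ : 0 ≤ β)
    (hx : ∀ f, prob w {S | f ∈ S} ≤ β * q f) {a : N → ℝ} {c : ℝ} (ha : ∀ f, 0 ≤ a f)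
    (hc : ∑ f, a f * q f ≤ c) {E : Set (Finset N)} (hE : ∀ S ∈ E, 1 ≤ ∑ f ∈ S, a f) :
    prob w E ≤ β * c := by
  calc prob w E ≤ ∑ S, w S * ∑ f ∈ S, a f :=
        prob_le_sum_mul hw (fun S => Finset.sum_nonneg fun f _ => ha f) hE
    _ = ∑ f, a f * prob w {S | f ∈ S} := sum_mul_sum_mem a
    _ ≤ ∑ f, a f * (β * q f) :=
        Finset.sum_le_sum fun f _ => mul_le_mul_of_nonneg_left (hx f) (ha f)
    _ = β * ∑ f, a f * q f := by rw [Finset.mul_sum]; exact Finset.sum_congr rfl fun f _ => by ring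
    _ ≤ β * c := mul_le_mul_of_nonneg_left hc hβ

/-- Markov's inequality combined with a linear inequality of the relaxation. -/
lemma InRelaxation.prob_le (hq : InRelaxation G q) (hw : ∀ S, 0 ≤ w S) (hβ : 0 ≤ β)
    (hx : ∀ f, prob w {S | f ∈ S} ≤ β * q f) {a : N → ℝ} {c : ℝ} (ha : ∀ f, 0 ≤ a f)
    (hT : ∀ T ∈ G, ∑ f ∈ T, a f ≤ c) {E : Set (Finset N)} (hE : ∀ S ∈ E, 1 ≤ ∑ f ∈ S, a f) :
    prob w E ≤ β * c :=
  prob_le_of_sum_mul_le hw hβ hx ha (hq a c ha hT) hE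

variable [DecidableEq N]

/-- A greedy contention resolution scheme for the constraint `G`: the services are split into two
classes, and for each class `s` a subfamily `F' s` of `G` is given which, for every nontrivial
service `e` of this class, blocks `e` with probability at most `2 * β` when the set of active
services is drawn according to `w`. -/
def Resolvable (β : ℝ) (w : Finset N → ℝ) (G : Set (Finset N)) : Prop :=
  ∃ (cls : N → Bool) (F' : Bool → Set (Finset N)), ∀ s, ∅ ∈ F' s ∧ F' s ⊆ G ∧
    ∀ e, cls e = s → {e} ∈ G → prob w {S | Blocks (F' s) e S} ≤ 2 * β

lemma resolvable_of_isKnapsackConstraint (hG : IsKnapsackConstraint G) (hq : InRelaxation G q)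
    (hw : ∀ S, 0 ≤ w S) (hβ : 0 ≤ β) (hx : ∀ f, prob w {S | f ∈ S} ≤ β * q f) :
    Resolvable β w G := by
  classical
  obtain ⟨s, B, rfl⟩ := hG
  -- A service is small if it takes at most half of the capacity. Big services are sold singly.
  set small : Set (Finset N) := {I | ∑ e ∈ I, s e ≤ B ∧ ∀ e ∈ I, 2 * s e ≤ B} with hsmall
  set big : Set (Finset N) := {I | ∑ e ∈ I, s e ≤ B ∧ I.card ≤ 1 ∧ ∀ e ∈ I, B < 2 * s e} with hbig
  have hbigBlocks : ∀ e, B < 2 * s e → s e ≤ B → prob w {S | Blocks big e S} ≤ 2 * β := by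
    intro e he heG
    refine (hq.prob_le hw hβ hx (a := fun f => if B < 2 * s f then 1 else 0) (c := 1)
      (fun f => by positivity) ?_ ?_).trans (by linarith)
    · intro T hT
      rw [Finset.sum_boole]
      by_contra! hcon
      have hcard : 1 < (T.filter fun f => B < 2 * s f).card := by exact_mod_cast hcon
      obtain ⟨x, hxT, y, hyT, hxy⟩ := Finset.one_lt_card.1 hcard
      simp only [Finset.mem_filter] at hxT hyT
      have h1 : s x + s y ≤ ∑ e ∈ T, s e := by
        rw [← Finset.sum_pair hxy]
        exact Finset.sum_le_sum_of_subset
          (Finset.insert_subset hxT.1 (Finset.singleton_subset_iff.2 hyT.1))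
      have h2 : B + B < 2 * s x + 2 * s y := add_lt_add hxT.2 hyT.2
      have h3 : (2 : ℝ≥0) * (s x + s y) ≤ 2 * B := by gcongr; exact h1.trans hT
      rw [mul_add, two_mul B] at h3
      exact absurd h2 (not_lt.2 h3)
    · rintro S ⟨I, hIS, ⟨hI1, hI2, hI4⟩, hI3⟩
      have hne : I.Nonempty := by
        by_contra hcon
        rw [Finset.not_nonempty_iff_eq_empty.1 hcon] at hI3
        exact hI3 ⟨by simpa using heG, by simp, by simpa using he⟩
      obtain ⟨f, hf⟩ := hne
      refine le_trans ?_ (Finset.single_le_sum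
        (f := fun f => if B < 2 * s f then (1 : ℝ) else 0) (fun g _ => by positivity)
        (Finset.mem_of_mem_erase (hIS hf)))
      simp [hI4 f hf]
  have hsmallBlocks : ∀ e, 2 * s e ≤ B → prob w {S | Blocks small e S} ≤ 2 * β := by
    intro e he
    -- A blocked small service comes after other active services of total size more than `B / 2`.
    have hhalf : ∀ S, Blocks small e S → (B : ℝ) < ∑ f ∈ S, 2 * (s f : ℝ) ∧ 0 < B := by
      rintro S ⟨I, hIS, ⟨hI1, hI2⟩, hI3⟩
      have heI : e ∉ I := fun h => Finset.notMem_erase e S (hIS h)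
      have h1 : B < s e + ∑ f ∈ I, s f := by
        by_contra! hcon
        refine hI3 ⟨by rwa [Finset.sum_insert heI], fun f hf => ?_⟩
        rcases Finset.mem_insert.1 hf with rfl | hf
        exacts [he, hI2 f hf]
      have h2 : ∑ f ∈ I, s f ≤ ∑ f ∈ S, s f :=
        Finset.sum_le_sum_of_subset (hIS.trans (Finset.erase_subset _ _))
      have he' : (2 : ℝ) * s e ≤ B := by exact_mod_cast he
      have h1' : (B : ℝ) < s e + ∑ f ∈ I, (s f : ℝ) := by exact_mod_cast h1
      have h2' : ∑ f ∈ I, (s f : ℝ) ≤ ∑ f ∈ S, (s f : ℝ) := by exact_mod_cast h2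
      refine ⟨by rw [← Finset.mul_sum]; linarith, ?_⟩
      by_contra! hB
      have hB0 : B = 0 := le_antisymm hB zero_le
      have h3 : ∀ f, 2 * s f ≤ B → s f = 0 := by
        intro f hf
        rw [hB0] at hf
        simpa using hf
      rw [h3 e he, Finset.sum_eq_zero fun f hf => h3 f (hI2 f hf), hB0] at h1
      simp at h1
    rcases (zero_le : 0 ≤ B).eq_or_lt with hB | hB
    · refine (prob_mono hw (E' := ∅) fun S hS => ?_).trans (by simpa [prob] using hβ)
      exact absurd (hhalf S hS).2 (by simp [← hB])
    · have hB' : (0 : ℝ) < B := hB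
      rw [mul_comm 2 β]
      refine hq.prob_le hw hβ hx (a := fun f => 2 * s f / B) (fun f => by positivity) ?_ ?_
      · intro T hT
        have hT' : ∑ f ∈ T, (s f : ℝ) ≤ B := by exact_mod_cast hT
        rw [← Finset.sum_div, ← Finset.mul_sum, div_le_iff₀ hB']
        linarith
      · intro S hS
        rw [← Finset.sum_div, le_div_iff₀ hB', one_mul]
        exact (hhalf S hS).1.le
  refine ⟨fun e => decide (2 * s e ≤ B), fun t => if t = true then small else big, ?_⟩
  rintro (_ | _)
  · refine ⟨by simp [hbig], fun I hI => ?_, fun e he heG => ?_⟩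
    · change I ∈ big at hI
      exact hI.1
    · simpa using hbigBlocks e (by simpa using he) (by simpa using heG)
  · refine ⟨by simp [hsmall], fun I hI => ?_, fun e he _ => ?_⟩
    · change I ∈ small at hI
      exact hI.1
    · simpa using hsmallBlocks e (by simpa using he)

lemma resolvable_of_isMatchingConstraint (hG : IsMatchingConstraint G) (hq : InRelaxation G q)
    (hw : ∀ S, 0 ≤ w S) (hβ : 0 ≤ β) (hx : ∀ f, prob w {S | f ∈ S} ≤ β * q f) :
    Resolvable β w G := by
  classical
  obtain ⟨V, ends, hloop, rfl⟩ := hG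
  refine ⟨fun _ => true, fun _ => _, fun _ => ⟨by simp, subset_rfl, fun e _ _ => ?_⟩⟩
  rw [mul_comm 2 β]
  obtain ⟨x, y, hxy⟩ : ∃ x y, ends e = s(x, y) := by
    induction h : ends e using Sym2.ind with | _ x y => exact ⟨x, y, rfl⟩
  refine hq.prob_le hw hβ hx
    (a := fun f => (if x ∈ ends f then 1 else 0) + (if y ∈ ends f then 1 else 0))
    (fun f => by positivity) ?_ ?_
  · intro T hT
    have h1 : ∀ z : V, (∑ f ∈ T, if z ∈ ends f then (1 : ℝ) else 0) ≤ 1 := by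
      intro z
      rw [Finset.sum_boole]
      by_contra! hcon
      have hcard : 1 < (T.filter fun f => z ∈ ends f).card := by exact_mod_cast hcon
      obtain ⟨f, hf, g, hg, hfg⟩ := Finset.one_lt_card.1 hcard
      simp only [Finset.mem_filter] at hf hg
      exact hT f hf.1 g hg.1 hfg z hf.2 hg.2
    rw [Finset.sum_add_distrib]
    linarith [h1 x, h1 y]
  · rintro S ⟨I, hIS, hI, hI'⟩
    -- Two edges of `I ∪ {e}` meet; as `I` is a matching, one of them is `e`.
    obtain ⟨f, hf, z, hze, hzf⟩ : ∃ f ∈ I, ∃ z, z ∈ ends e ∧ z ∈ ends f := by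
      by_contra! hcon
      refine hI' fun f hf g hg hfg z hzf hzg => ?_
      rcases Finset.mem_insert.1 hf with rfl | hf' <;> rcases Finset.mem_insert.1 hg with rfl | hg'
      · exact hfg rfl
      · exact hcon g hg' z hzf hzg
      · exact hcon f hf' z hzg hzf
      · exact hI f hf' g hg' hfg z hzf hzg
    have hfS : f ∈ S := Finset.mem_of_mem_erase (hIS hf)
    refine le_trans ?_ (Finset.single_le_sum (f := fun f => (if x ∈ ends f then (1 : ℝ) else 0) +
      (if y ∈ ends f then 1 else 0)) (fun g _ => by positivity) hfS)
    rw [hxy, Sym2.mem_iff] at hze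
    rcases hze with rfl | rfl
    · simp only [hzf, if_true]
      split_ifs <;> norm_num
    · simp only [hzf, if_true]
      split_ifs <;> norm_num

/-- The chain construction for a matroid with rank function `r`, by induction on `A`. Let `S ⊆ A` be
maximal such that adding `S` to the active services of `A` raises their expected rank by at most
`(1 - 2 * β) * r S`. By maximality, the active services together with `S` span a given `e ∈ A \ S`
with probability at most `2 * β`, so on `A \ S` the independent sets of the contraction
by `S` are used. The induction hypothesis takes care of `S`, which is not all of `A` since the
expected number of active services is small compared with the rank of `A`. -/
lemma exists_family_of_rank {r : Finset N → ℕ} (hmono : Monotone r)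
    (hsub : ∀ S T, r (S ∪ T) + r (S ∩ T) ≤ r S + r T) (hcard : ∀ S, r S ≤ S.card)
    (hw : ∀ S, 0 ≤ w S) (hw1 : ∑ S, w S = 1) (hβ : 0 < β)
    (hx : ∀ A : Finset N, ∑ S, w S * ((S ∩ A).card : ℝ) ≤ β * r A) (A : Finset N)
    (hA : ∀ e ∈ A, 0 < r {e}) :
    ∃ F' : Set (Finset N), ∅ ∈ F' ∧ (∀ I ∈ F', I ⊆ A ∧ r I = I.card) ∧
      ∀ e ∈ A, prob w {S | Blocks F' e S} ≤ 2 * β := by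
  classical
  have hins : ∀ e S, r (insert e S) ≤ r S + 1 := by
    intro e S
    have h1 := hsub {e} S
    have h2 := hcard {e}
    rw [← Finset.insert_eq] at h1
    simp only [Finset.card_singleton] at h2
    omega
  have hflat : ∀ e S Y, S ⊆ Y → r (insert e S) = r S → r (insert e Y) = r Y := by
    intro e S Y hSY h
    have h1 := hsub (insert e S) Y
    have h2 : r S ≤ r (insert e S ∩ Y) :=
      hmono (Finset.subset_inter (Finset.subset_insert _ _) hSY)
    have h3 : insert e S ∪ Y = insert e Y := by
      rw [Finset.insert_union, Finset.union_eq_right.2 hSY]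
    rw [h3] at h1
    have h4 : r Y ≤ r (insert e Y) := hmono (Finset.subset_insert _ _)
    omega
  have hempty : r ∅ = 0 := Nat.le_zero.1 (hcard ∅)
  induction A using Finset.strongInduction with
  | H A ih =>
  rcases A.eq_empty_or_nonempty with rfl | hne
  · exact ⟨{∅}, by simp, by simp [hempty], by simp⟩
  -- `E S` is the expected rank of the active services of `A` together with `S`.
  set E : Finset N → ℝ := fun S => ∑ R, w R * (r (R ∩ A ∪ S) : ℝ) with hE
  obtain ⟨S, hS, hSmax⟩ := Finset.exists_max_image
    (A.powerset.filter fun S => E S ≤ E ∅ + (1 - 2 * β) * r S) Finset.card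
    ⟨∅, by simp [hempty]⟩
  simp only [Finset.mem_filter, Finset.mem_powerset] at hS hSmax
  obtain ⟨hSA, hSE⟩ := hS
  have hSne : S ≠ A := by
    rintro rfl
    obtain ⟨e, he⟩ := hne
    have h1 : (0 : ℝ) < r S := by
      exact_mod_cast (hA e he).trans_le (hmono (Finset.singleton_subset_iff.2 he))
    have h2 : E S = r S := by
      simp only [hE]
      rw [← one_mul (r S : ℝ), ← hw1, Finset.sum_mul]
      refine Finset.sum_congr rfl fun R _ => ?_
      rw [Finset.union_eq_right.2 Finset.inter_subset_right]
    have h3 : E ∅ ≤ β * r S := by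
      refine le_trans (Finset.sum_le_sum fun R _ => ?_) (hx S)
      rw [Finset.union_empty]
      exact mul_le_mul_of_nonneg_left (by exact_mod_cast hcard _) (hw R)
    nlinarith
  obtain ⟨F', hF0, hF', hFb⟩ := ih S (hSA.ssubset_of_ne hSne) fun e he => hA e (hSA he)
  refine ⟨{I | I ⊆ A ∧ I ∩ S ∈ F' ∧ r (I ∪ S) = (I \ S).card + r S}, ?_, ?_, ?_⟩
  · simp [hF0]
  · rintro I ⟨hIA, hIS, hI⟩
    refine ⟨hIA, le_antisymm (hcard I) ?_⟩
    have h1 := hsub I S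
    have h2 := (hF' _ hIS).2
    have h3 := Finset.card_sdiff_add_card_inter I S
    omega
  · intro e heA
    by_cases heS : e ∈ S
    · refine (prob_mono hw ?_).trans (hFb e heS)
      rintro R ⟨I, hIR, ⟨hIA, hIS, hI⟩, hI'⟩
      refine ⟨I ∩ S, Finset.inter_subset_left.trans hIR, hIS, fun hcon => hI' ⟨?_, ?_, ?_⟩⟩
      · exact Finset.insert_subset heA hIA
      · rwa [Finset.insert_inter_of_mem heS]
      · rw [Finset.insert_union, Finset.insert_eq_of_mem (Finset.mem_union_right _ heS),
          Finset.insert_sdiff_of_mem _ heS, hI]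
    · have hnot : E ∅ + (1 - 2 * β) * r (insert e S) < E (insert e S) := by
        by_contra! hcon
        have := hSmax (insert e S) ⟨Finset.insert_subset heA hSA, hcon⟩
        rw [Finset.card_insert_of_notMem heS] at this
        omega
      have hdiff : (1 - 2 * β) * ((r (insert e S) : ℝ) - r S) < E (insert e S) - E S := by
        linarith
      have hEdiff : E (insert e S) - E S =
          ∑ R, w R * ((r (insert e (R ∩ A ∪ S)) : ℝ) - r (R ∩ A ∪ S)) := by
        simp only [hE, ← Finset.sum_sub_distrib, ← mul_sub, Finset.union_insert]
      have hrk : r (insert e S) = r S + 1 := by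
        have h1 := hins e S
        have h2 : r S ≤ r (insert e S) := hmono (Finset.subset_insert _ _)
        by_contra hcon
        have h3 : r (insert e S) = r S := by omega
        rw [h3, hEdiff, Finset.sum_eq_zero] at hdiff
        · simp at hdiff
        · intro R _
          rw [hflat e S _ Finset.subset_union_right h3]
          simp
      rw [hrk] at hdiff
      push_cast at hdiff
      have hZ : E (insert e S) - E S +
          prob w {R | r (insert e (R ∩ A ∪ S)) = r (R ∩ A ∪ S)} ≤ 1 := by
        rw [hEdiff, prob, ← Finset.sum_add_distrib, ← hw1]
        refine Finset.sum_le_sum fun R _ => ?_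
        by_cases hR : r (insert e (R ∩ A ∪ S)) = r (R ∩ A ∪ S)
        · rw [Set.indicator_of_mem (by exact hR), hR]
          simp
        · rw [Set.indicator_of_notMem (by exact hR), add_zero]
          refine mul_le_of_le_one_right (hw R) ?_
          have : (r (insert e (R ∩ A ∪ S)) : ℝ) ≤ r (R ∩ A ∪ S) + 1 := by
            exact_mod_cast hins e _
          linarith
      refine (prob_mono hw ?_).trans (by linarith : prob w
        {R | r (insert e (R ∩ A ∪ S)) = r (R ∩ A ∪ S)} ≤ 2 * β)
      rintro R ⟨I, hIR, ⟨hIA, hIS, hI⟩, hI'⟩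
      have heI : e ∉ I := fun h => Finset.notMem_erase e R (hIR h)
      have h1 : r (insert e (I ∪ S)) ≠ r (I ∪ S) + 1 := by
        intro hcon
        refine hI' ⟨Finset.insert_subset heA hIA, ?_, ?_⟩
        · rwa [Finset.insert_inter_of_notMem heS]
        · rw [Finset.insert_union, Finset.insert_sdiff_of_notMem _ heS,
            Finset.card_insert_of_notMem (by simp [heI]), hcon, hI]
          omega
      have h2 := hins e (I ∪ S)
      have h3 : r (I ∪ S) ≤ r (insert e (I ∪ S)) := hmono (Finset.subset_insert _ _)
      refine hflat e (I ∪ S) _ ?_ (by omega)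
      refine Finset.union_subset_union_left (Finset.subset_inter ?_ hIA)
      exact hIR.trans (Finset.erase_subset _ _)

lemma resolvable_of_isMatroidConstraint (hG : IsMatroidConstraint G) (hq : InRelaxation G q)
    (hw : ∀ S, 0 ≤ w S) (hw1 : ∑ S, w S = 1) (hβ : 0 < β)
    (hx : ∀ f, prob w {S | f ∈ S} ≤ β * q f) :
    Resolvable β w G := by
  classical
  obtain ⟨M, -, rfl⟩ := hG
  obtain ⟨r, hind, hmono, hsub, hcard⟩ := exists_rank M
  have hrank : ∀ A : Finset N, ∑ S, w S * ((S ∩ A).card : ℝ) ≤ β * r A := by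
    intro A
    have h1 : ∀ S : Finset N, ((S ∩ A).card : ℝ) = ∑ f ∈ S, if f ∈ A then 1 else 0 := by
      intro S
      rw [Finset.sum_boole, Finset.filter_mem_eq_inter]
    simp_rw [h1, sum_mul_sum_mem]
    calc ∑ f, (if f ∈ A then 1 else 0) * prob w {S | f ∈ S}
        ≤ ∑ f, (if f ∈ A then 1 else 0) * (β * q f) :=
          Finset.sum_le_sum fun f _ => mul_le_mul_of_nonneg_left (hx f) (by positivity)
      _ = β * ∑ f, (if f ∈ A then 1 else 0) * q f := by
          rw [Finset.mul_sum]; exact Finset.sum_congr rfl fun f _ => by ring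
      _ ≤ β * r A := by
          refine mul_le_mul_of_nonneg_left (hq _ _ (fun f => by positivity) fun T hT => ?_) hβ.le
          rw [← h1]
          have h2 : r (T ∩ A) = (T ∩ A).card :=
            (hind _).1 (Matroid.Indep.subset hT (by simp))
          rw [← h2]
          exact_mod_cast hmono Finset.inter_subset_right
  obtain ⟨F', h0, hF, hb⟩ := exists_family_of_rank (β := β) hmono hsub hcard hw hw1 hβ
    hrank (Finset.univ.filter fun e => 0 < r {e}) (by simp)
  refine ⟨fun _ => true, fun _ => F', fun _ => ⟨h0, fun I hI => ?_, fun e _ he => hb e ?_⟩⟩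
  · exact (hind I).2 (hF I hI).2
  · have := (hind {e}).1 he
    simp [this]

end Resolution

/-! ### Resampling one coordinate -/

/-- Redrawing one coordinate of a random vector with independent entries does not change its
law. -/
lemma lintegral_pi_eq_lintegral_update {N : Type*} [Fintype N] [DecidableEq N] {X : N → Type*}
    [∀ j, MeasurableSpace (X j)] (μ : ∀ j, Measure (X j)) [∀ j, IsProbabilityMeasure (μ j)]
    {f : (∀ j, X j) → ℝ≥0∞} (hf : Measurable f) (e : N) :
    ∫⁻ x, f x ∂Measure.pi μ = ∫⁻ x, ∫⁻ t, f (Function.update x e t) ∂μ e ∂Measure.pi μ := by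
  rcases isEmpty_or_nonempty (∀ j, X j) with h | ⟨⟨x₀⟩⟩
  · simp [lintegral_of_isEmpty]
  rw [lintegral_eq_lmarginal_univ x₀, lintegral_eq_lmarginal_univ x₀]
  refine congrFun (lmarginal_eq_of_subset (s := {e}) (Finset.subset_univ _) hf ?_ ?_) x₀
  · have := hf.lmarginal μ (s := {e})
    rwa [lmarginal_singleton] at this
  · rw [lmarginal_singleton, lmarginal_singleton]
    ext x
    simp

/-! ### Revenue of a posted price mechanism built from contention resolution schemes -/

lemma PostedPricing.Run.mem_of_forall_insert_mem {A N : Type*} [DecidableEq N]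
    {F : Set (Finset N)} {m : PostedPricing F} {owner : N → A} {v : N → ℝ≥0} {l : List A}
    {S T : Finset N} (h : m.Run owner v l S T) {R : Finset N}
    (hR : ∀ j I, insert j I ∈ m.allowed → m.price j ≤ v j → j ∈ R) {e : N}
    (he : m.price e ≤ v e) (hout : ∀ f ∈ R.erase e, owner f ≠ owner e)
    (hblock : ∀ I ⊆ R.erase e, I ∈ m.allowed → insert e I ∈ m.allowed) (hSR : S ⊆ R)
    (hS : S ∈ m.allowed) (hl : owner e ∈ l ∨ e ∈ S) : e ∈ T := by
  induction h with
  | done S => simpa using hl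
  | skip i l S T hskip hrest ih =>
    by_cases heS : e ∈ S
    · exact ih hSR hS (Or.inr heS)
    refine ih hSR hS (Or.inl ((List.mem_cons.1 (hl.resolve_right heS)).resolve_left fun hi => ?_))
    refine absurd he (not_le.2 (hskip e ⟨hi, hblock S ?_ hS⟩))
    exact Finset.subset_erase.2 ⟨hSR, heS⟩
  | buy i l S T j hoffer haccept hbest hrest ih =>
    have hjR : j ∈ R := hR j S hoffer.2 haccept
    refine ih (Finset.insert_subset hjR hSR) hoffer.2 ?_
    by_cases heS : e ∈ S
    · exact Or.inr (Finset.mem_insert_of_mem heS)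
    rcases List.mem_cons.1 (hl.resolve_right heS) with hi | hi
    · refine Or.inr ?_
      by_contra hcon
      have hje : j ≠ e := by
        rintro rfl
        exact hcon (Finset.mem_insert_self _ _)
      exact hout j (Finset.mem_erase.2 ⟨hje, hjR⟩) (hoffer.1.trans hi.symm)
    · exact Or.inl hi

lemma subset_mem_of_isConstraint {N : Type*} {G : Set (Finset N)}
    (hG : IsMatroidConstraint G ∨ IsKnapsackConstraint G ∨ IsMatchingConstraint G)
    {S T : Finset N} (hT : T ∈ G) (hST : S ⊆ T) : S ∈ G := by
  rcases hG with ⟨M, -, rfl⟩ | ⟨s, B, rfl⟩ | ⟨V, ends, -, rfl⟩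
  · exact Matroid.Indep.subset hT (by exact_mod_cast hST)
  · exact (Finset.sum_le_sum_of_subset (f := s) hST).trans (show ∑ e ∈ T, s e ≤ B from hT)
  · exact fun e he f hf => hT e (hST he) f (hST hf)

lemma prob_law {N Ω : Type*} [Fintype N] [MeasurableSpace Ω] (P : Measure Ω)
    [IsProbabilityMeasure P] {R : Ω → Finset N} (hR : ∀ E : Set (Finset N), MeasurableSet (R ⁻¹' E))
    (E : Set (Finset N)) : prob (fun S => P.real (R ⁻¹' {S})) E = P.real (R ⁻¹' E) := by
  classical
  have h : R ⁻¹' E = ⋃ S ∈ (Finset.univ.filter fun S => S ∈ E), R ⁻¹' {S} := by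
    ext ω
    simp
  rw [h, measureReal_biUnion_finset _ fun S _ => hR {S}]
  · rw [prob, Finset.sum_filter]
    refine Finset.sum_congr rfl fun S _ => ?_
    rw [Set.indicator_apply]
  · intro S _ T _ hST
    exact Disjoint.preimage _ (by simpa using hST)

section Revenue

variable {A N : Type*} [Fintype N] [DecidableEq N]

/-- The supremum of the expected revenues of the deterministic posted price mechanisms. -/
noncomputable def supRevenue (owner : N → A) (F : Set (Finset N)) (D : N → Measure ℝ≥0) :
    ℝ≥0∞ :=
  ⨆ m : PostedPricing F, ∫⁻ v, m.worstCaseRevenue owner v ∂(Measure.pi D)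

/-- The services that are switched on and whose values reach their prices. -/
noncomputable def active (p : N → ℝ≥0) (ω : N → ℝ≥0 × Bool) : Finset N :=
  Finset.univ.filter fun e => p e ≤ (ω e).1 ∧ (ω e).2 = true

omit [DecidableEq N] in
lemma mem_active {p : N → ℝ≥0} {ω : N → ℝ≥0 × Bool} {e : N} :
    e ∈ active p ω ↔ p e ≤ (ω e).1 ∧ (ω e).2 = true := by
  simp [active]

omit [DecidableEq N] in
lemma measurableSet_active (p : N → ℝ≥0) (E : Set (Finset N)) :
    MeasurableSet (active p ⁻¹' E) := by
  have h : active p ⁻¹' E = ⋃ S ∈ E, {ω | ∀ e, (p e ≤ (ω e).1 ∧ (ω e).2 = true) ↔ e ∈ S} := by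
    ext ω
    simp only [Set.mem_preimage, Set.mem_iUnion, Set.mem_ofPred_eq, exists_prop]
    constructor
    · exact fun h => ⟨_, h, fun e => by simp [active]⟩
    · rintro ⟨S, hS, h⟩
      rwa [show active p ω = S by ext e; simp [active, h]]
  rw [h]
  refine MeasurableSet.biUnion (Set.to_countable E) fun S _ => ?_
  refine measurableSet_setOfPred.2 (Measurable.forall fun e => Measurable.iff ?_ measurable_const)
  refine Measurable.and ?_ ?_
  · exact measurableSet_setOfPred.1 (measurableSet_le measurable_const (measurable_pi_apply e).fst)
  · exact measurableSet_setOfPred.1 ((measurable_pi_apply e).snd (measurableSet_singleton true))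

lemma active_update_erase (p : N → ℝ≥0) (ω : N → ℝ≥0 × Bool) (e : N) (t : ℝ≥0 × Bool) :
    (active p (Function.update ω e t)).erase e = (active p ω).erase e := by
  ext f
  simp only [Finset.mem_erase, mem_active]
  refine and_congr_right fun hf => ?_
  rw [Function.update_of_ne hf]

/-- The set of active services is split by `e` into two independent parts. -/
lemma measure_mem_active_and (μ : N → Measure (ℝ≥0 × Bool)) [∀ j, IsProbabilityMeasure (μ j)]
    (p : N → ℝ≥0) (e : N) (E : Set (Finset N)) :
    Measure.pi μ {ω | e ∈ active p ω ∧ (active p ω).erase e ∈ E} =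
      μ e {t | p e ≤ t.1 ∧ t.2 = true} * Measure.pi μ {ω | (active p ω).erase e ∈ E} := by
  have hE : MeasurableSet {ω | (active p ω).erase e ∈ E} :=
    measurableSet_active p {S | S.erase e ∈ E}
  have hmem : MeasurableSet {ω | e ∈ active p ω ∧ (active p ω).erase e ∈ E} :=
    measurableSet_active p {S | e ∈ S ∧ S.erase e ∈ E}
  have ht : MeasurableSet {t : ℝ≥0 × Bool | p e ≤ t.1 ∧ t.2 = true} :=
    (measurableSet_le measurable_const measurable_fst).inter
      (measurable_snd (measurableSet_singleton true))
  rw [← lintegral_indicator_one hmem,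
    lintegral_pi_eq_lintegral_update μ (measurable_one.indicator hmem) e,
    ← lintegral_indicator_one hE, ← lintegral_const_mul _ (measurable_one.indicator hE)]
  refine lintegral_congr fun ω => ?_
  by_cases hω : (active p ω).erase e ∈ E
  · rw [Set.indicator_of_mem (by exact hω), Pi.one_apply, mul_one, ← lintegral_indicator_one ht]
    refine lintegral_congr fun t => Set.indicator_eq_indicator ?_ rfl
    simp [active_update_erase, hω, mem_active]
  · rw [Set.indicator_of_notMem (by exact hω), mul_zero]
    refine (lintegral_congr fun t => ?_).trans lintegral_zero
    exact Set.indicator_of_notMem (by simp [active_update_erase, hω]) _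

end Revenue

section Revenue

variable {A N : Type*} [Fintype N] [DecidableEq N]
  {k : ℕ} {F : Set (Finset N)} {owner : N → A} {D : N → Measure ℝ≥0}
  [∀ j, IsProbabilityMeasure (D j)]

/-- A service `e` is sold whatever the adversary does if it is active, no other active service has
the same owner, and `e` is blocked in none of the families `H l`. The average over the coins of the
revenues of the mechanisms restricted to `⋂ l, H l` and to the services switched on is thus at
least the expected total price of these services. -/
lemma sum_price_mul_measure_le_supRevenue {ι : Type*} (coin : N → Measure Bool)
    [∀ j, IsProbabilityMeasure (coin j)] (p : N → ℝ≥0) (H : ι → Set (Finset N))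
    (H0 : ∀ l, ∅ ∈ H l) (HF : ⋂ l, H l ⊆ F) (s : Finset N) :
    ∑ e ∈ s, (p e : ℝ≥0∞) * Measure.pi (fun j => (D j).prod (coin j))
      {ω | e ∈ active p ω ∧ (active p ω).erase e ∈
        {S | (∀ f ∈ S, owner f ≠ owner e) ∧ ∀ l, ¬ Blocks (H l) e S}} ≤
      supRevenue owner F D := by
  classical
  set E : N → Set (Finset N) := fun e =>
    {S | e ∈ S ∧ (∀ f ∈ S.erase e, owner f ≠ owner e) ∧ ∀ l, ¬ Blocks (H l) e (S.erase e)}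
  set g : (N → ℝ≥0 × Bool) → ℝ≥0∞ := fun ω =>
    ∑ e ∈ s, (active p ⁻¹' E e).indicator (fun _ => (p e : ℝ≥0∞)) ω with hg
  have hgm : Measurable g := Finset.measurable_sum _ fun e _ =>
    measurable_const.indicator (measurableSet_active p (E e))
  have hmp := (measurePreserving_arrowProdEquivProdArrow ℝ≥0 Bool N D coin).symm
  calc ∑ e ∈ s, (p e : ℝ≥0∞) * Measure.pi (fun j => (D j).prod (coin j)) (active p ⁻¹' E e)
      = ∫⁻ ω, g ω ∂Measure.pi (fun j => (D j).prod (coin j)) := by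
        rw [lintegral_finsetSum _ fun e _ =>
          measurable_const.indicator (measurableSet_active p (E e))]
        exact Finset.sum_congr rfl fun e _ =>
          (lintegral_indicator_const (measurableSet_active p (E e)) _).symm
    _ = ∫⁻ z, g (fun e => (z.1 e, z.2 e)) ∂(Measure.pi D).prod (Measure.pi coin) :=
        (hmp.lintegral_comp hgm).symm
    _ = ∫⁻ c, ∫⁻ v, g (fun e => (v e, c e)) ∂Measure.pi D ∂Measure.pi coin :=
        lintegral_prod_symm _ (hgm.comp hmp.measurable).aemeasurable
    _ ≤ ∫⁻ _, supRevenue owner F D ∂Measure.pi coin := lintegral_mono fun c => ?_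
    _ = supRevenue owner F D := by simp
  -- For fixed coins `c`, the mechanism sells only services that are switched on.
  let m : PostedPricing F := ⟨p, {I | (∀ e ∈ I, c e = true) ∧ ∀ l, I ∈ H l},
    fun I hI => HF (Set.mem_iInter.2 hI.2)⟩
  refine le_trans (lintegral_mono fun v => ?_) (le_iSup (fun m : PostedPricing F =>
    ∫⁻ v, m.worstCaseRevenue owner v ∂(Measure.pi D)) m)
  refine le_iInf fun l => le_iInf fun T => le_iInf fun hl => le_iInf fun hrun => ?_
  simp only [hg, Set.indicator_apply]
  rw [← Finset.sum_filter]
  refine Finset.sum_le_sum_of_subset fun e he => ?_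
  obtain ⟨-, heact, hout, hblock⟩ := Finset.mem_filter.1 he
  have heact' := mem_active.1 heact
  refine hrun.mem_of_forall_insert_mem (R := active p fun e => (v e, c e)) ?_ heact'.1 hout ?_
    (Finset.empty_subset _) ⟨by simp, H0⟩ (Or.inl (hl.2 _))
  · exact fun j I hI hj => mem_active.2 ⟨hj, hI.1 j (Finset.mem_insert_self _ _)⟩
  · refine fun I hI hIm => ⟨fun f hf => ?_, fun l => ?_⟩
    · rcases Finset.mem_insert.1 hf with rfl | hf
      exacts [heact'.2, hIm.1 f hf]
    · by_contra hcon
      exact hblock l ⟨I, by rwa [Finset.erase_idem], hIm.2 l, hcon⟩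

/-- Contention resolution turns prices `p` and activation probabilities in the relaxation of `F`
into the revenue of an actual mechanism, up to a constant factor. -/
theorem sum_price_mul_min_le [DecidableEq A] (hF : IsIntersectionOfConstraints k F) {q : N → ℝ≥0}
    (hq : InRelaxation F fun e => (q e : ℝ))
    (hq1 : ∀ i, ∑ e, (if owner e = i then q e else 0) ≤ 1) (p : N → ℝ≥0) :
    ∑ e, (p e : ℝ≥0∞) * min (D e (Set.Ici (p e))) (q e) ≤
      ((2 ^ k * (8 * (k + 1)) : ℝ≥0) : ℝ≥0∞) * supRevenue owner F D := by
  classical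
  obtain ⟨G, hG, rfl⟩ := hF
  -- With this scaling the failure probabilities of the `k + 1` schemes add up to at most `1 / 2`.
  set β : ℝ≥0 := 1 / (4 * (k + 1)) with hβ
  have hβ0 : 0 < β := by positivity
  have hβ1 : β ≤ 1 := by
    rw [hβ, div_le_one (by positivity)]
    exact_mod_cast (by omega : 1 ≤ 4 * (k + 1))
  set g : N → ℝ≥0 := fun e => (D e (Set.Ici (p e))).toNNReal with hg
  have hgD : ∀ e, D e (Set.Ici (p e)) = g e := fun e =>
    (ENNReal.coe_toNNReal (measure_ne_top _ _)).symm
  set x : N → ℝ≥0 := fun e => β * min (g e) (q e) with hx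
  have hxg : ∀ e, x e ≤ g e := fun e =>
    (mul_le_mul' hβ1 (min_le_left _ _)).trans (one_mul _).le
  have hρ1 : ∀ e, x e / g e ≤ 1 := fun e => div_le_one_of_le₀ (hxg e) zero_le
  have hρ : ∀ e, g e * (x e / g e) = x e := by
    intro e
    rcases eq_or_ne (g e) 0 with h | h
    · have : x e = 0 := le_antisymm (h ▸ hxg e) zero_le
      rw [this, h, zero_mul]
    · exact mul_div_cancel₀ _ h
  set coin : N → Measure Bool := fun e =>
    ProbabilityTheory.bernoulliMeasure true false ⟨x e / g e, by positivity, hρ1 e⟩ with hcoin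
  set P := Measure.pi fun j => (D j).prod (coin j) with hP
  have hact : ∀ e, (D e).prod (coin e) {t | p e ≤ t.1 ∧ t.2 = true} = x e := by
    intro e
    have h1 : {t : ℝ≥0 × Bool | p e ≤ t.1 ∧ t.2 = true} = Set.Ici (p e) ×ˢ {true} := by
      ext t
      simp
    rw [h1, Measure.prod_prod, hgD, hcoin,
      ProbabilityTheory.bernoulliMeasure_apply_of_mem_of_notMem _ (by simp) (by simp) (by simp)]
    exact_mod_cast hρ e
  set w : Finset N → ℝ := fun S => P.real (active p ⁻¹' {S}) with hw
  have hlaw : ∀ E, prob w E = P.real (active p ⁻¹' E) := prob_law P (measurableSet_active p)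
  have hw0 : ∀ S, 0 ≤ w S := fun S => measureReal_nonneg
  have hw1 : ∑ S, w S = 1 := by
    have := hlaw Set.univ
    simpa [prob] using this
  have hxw : ∀ f, prob w {S | f ∈ S} ≤ (β : ℝ) * q f := by
    intro f
    have h1 := measure_mem_active_and (fun j => (D j).prod (coin j)) p f Set.univ
    simp only [Set.mem_univ, and_true, hact, Set.ofPred_true, measure_univ, mul_one] at h1
    rw [hlaw, measureReal_def]
    rw [show active p ⁻¹' {S | f ∈ S} = {ω | f ∈ active p ω} from rfl, h1]
    simp only [ENNReal.coe_toReal, hx]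
    push_cast
    gcongr
    exact min_le_right _ _
  have hres : ∀ l, Resolvable β w (G l) := by
    intro l
    have hql := hq.mono (Set.iInter_subset G l)
    rcases hG l with h | h | h
    · exact resolvable_of_isMatroidConstraint h hql hw0 hw1 (by exact_mod_cast hβ0) hxw
    · exact resolvable_of_isKnapsackConstraint h hql hw0 β.coe_nonneg hxw
    · exact resolvable_of_isMatchingConstraint h hql hw0 β.coe_nonneg hxw
  choose cls F' hF' using hres
  -- A service that is used with positive probability can be sold alone.
  have hsing : ∀ e, q e ≠ 0 → ∀ l, {e} ∈ G l := by
    intro e he l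
    by_contra hcon
    refine he (le_antisymm (NNReal.coe_le_coe.1 ?_) zero_le)
    have := hq (fun f => if f = e then 1 else 0) 0 (fun f => by positivity) fun T hT => ?_
    · simpa using this
    · have heT : e ∉ T := fun h => hcon (subset_mem_of_isConstraint (hG l) (Set.mem_iInter.1 hT l)
        (Finset.singleton_subset_iff.2 h))
      simp [heT]
  have hclass : ∀ c : Fin k → Bool, ∑ e with (fun l => cls l e) = c,
      (p e : ℝ≥0∞) * ((x e / 2 : ℝ≥0) : ℝ≥0∞) ≤ supRevenue owner (⋂ l, G l) D := by
    intro c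
    refine le_trans (Finset.sum_le_sum fun e he => ?_) (sum_price_mul_measure_le_supRevenue coin p
      (fun l => F' l (c l)) (fun l => (hF' l (c l)).1)
      (Set.iInter_mono fun l => (hF' l (c l)).2.1) _)
    obtain rfl : (fun l => cls l e) = c := (Finset.mem_filter.1 he).2
    rw [measure_mem_active_and, hact]
    gcongr
    rcases eq_or_ne (q e) 0 with hq0 | hq0
    · simp [hx, hq0]
    rw [div_eq_mul_inv, ENNReal.coe_mul]
    gcongr
    set ok : Set (Finset N) := {S | (∀ f ∈ S.erase e, owner f ≠ owner e) ∧
      ∀ l, ¬ Blocks (F' l (cls l e)) e (S.erase e)} with hok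
    have hbad : P.real (active p ⁻¹' ok)ᶜ ≤ 1 / 2 := by
      have hsub : (active p ⁻¹' ok)ᶜ ⊆ active p ⁻¹' {S | ∃ f ∈ S.erase e, owner f = owner e} ∪
          ⋃ l, active p ⁻¹' {S | Blocks (F' l (cls l e)) e S} := by
        intro ω hω
        by_contra hcon
        simp only [Set.mem_union, Set.mem_iUnion, not_or, not_exists] at hcon
        refine hω ⟨fun f hf hfe => hcon.1 ⟨f, hf, hfe⟩, fun l ⟨I, hI, hI'⟩ => hcon.2 l ⟨I, ?_, hI'⟩⟩
        rwa [Finset.erase_idem] at hI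
      have h1 : P.real (active p ⁻¹' {S | ∃ f ∈ S.erase e, owner f = owner e}) ≤ β * 1 := by
        rw [← hlaw]
        refine prob_le_of_sum_mul_le hw0 β.coe_nonneg hxw
          (a := fun f => if owner f = owner e then 1 else 0) (fun f => by positivity) ?_ ?_
        · have := hq1 (owner e)
          rw [← NNReal.coe_le_coe] at this
          push_cast [apply_ite] at this
          simpa using this
        · rintro S ⟨f, hf, hfe⟩
          refine le_trans ?_ (Finset.single_le_sum
            (f := fun f => if owner f = owner e then (1 : ℝ) else 0) (fun g _ => by positivity)
            (Finset.mem_of_mem_erase hf))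
          simp [hfe]
      have h2 : P.real (⋃ l, active p ⁻¹' {S | Blocks (F' l (cls l e)) e S}) ≤ k * (2 * β) := by
        refine (measureReal_iUnion_fintype_le _).trans ?_
        refine (Finset.sum_le_sum fun l _ => ?_).trans (b := ∑ _l : Fin k, 2 * (β : ℝ)) (by simp)
        rw [← hlaw]
        exact (hF' l (cls l e)).2.2 e rfl (hsing e hq0 l)
      have h3 : (β : ℝ) * (4 * (k + 1)) = 1 := by
        rw [hβ]
        push_cast
        field_simp
      have h4 := (measureReal_mono (μ := P) hsub).trans (measureReal_union_le _ _)
      linarith [β.coe_nonneg]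
    rw [probReal_compl_eq_one_sub (measurableSet_active p ok)] at hbad
    have h5 : (1 / 2 : ℝ) ≤ P.real (active p ⁻¹' ok) := by linarith
    rw [measureReal_def, ← ENNReal.ofReal_le_iff_le_toReal (measure_ne_top _ _)] at h5
    refine le_trans (le_of_eq ?_) h5
    simp
  calc ∑ e, (p e : ℝ≥0∞) * min (D e (Set.Ici (p e))) (q e)
      = ∑ e, ((8 * (k + 1) : ℝ≥0) : ℝ≥0∞) * ((p e : ℝ≥0∞) * ((x e / 2 : ℝ≥0) : ℝ≥0∞)) := by
        refine Finset.sum_congr rfl fun e _ => ?_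
        rw [hgD, ← ENNReal.coe_min]
        norm_cast
        simp only [hx, hβ]
        push_cast
        field_simp
        ring
    _ = ((8 * (k + 1) : ℝ≥0) : ℝ≥0∞) * ∑ c : Fin k → Bool, ∑ e with (fun l => cls l e) = c,
          (p e : ℝ≥0∞) * ((x e / 2 : ℝ≥0) : ℝ≥0∞) := by
        rw [← Finset.mul_sum, Finset.sum_fiberwise]
    _ ≤ ((8 * (k + 1) : ℝ≥0) : ℝ≥0∞) * ∑ c : Fin k → Bool, supRevenue owner (⋂ l, G l) D := by
        gcongr with c
        exact hclass c
    _ = _ := by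
        rw [Finset.sum_const, Finset.card_univ, Fintype.card_fun, Fintype.card_fin,
          Fintype.card_bool, nsmul_eq_mul, ← mul_assoc]
        push_cast
        ring

end Revenue

/-! ### A single price does as well as a monotone allocation rule -/

/-- `y` is a monotone allocation rule for a single service whose value has the law `ν`, and `P`
is the corresponding payment. If posted prices above `β` raise at most `w`, then `P` raises at
most `2 * w` on top of what is paid at the rate `2 * β`. The allocation rule is decomposed into
posted prices `2 * β, 4 * β, 8 * β, …`. -/
lemma lintegral_payment_le {ν : Measure ℝ≥0} {y P : ℝ≥0 → ℝ} (hy : Monotone y)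
    (hy0 : ∀ t, 0 ≤ y t) (hy1 : ∀ t, y t ≤ 1) (hP0 : P 0 ≤ 0)
    (hP : ∀ s t, s ≤ t → P t - P s ≤ t * (y t - y s)) {β : ℝ≥0} (hβ : 0 < β) {w : ℝ≥0∞}
    (hw : ∀ p : ℝ≥0, β < p → p * ν (Set.Ici p) ≤ w) :
    ∫⁻ t, ENNReal.ofReal (P t) ∂ν ≤ 2 * β * ∫⁻ t, ENNReal.ofReal (y t) ∂ν + 2 * w := by
  set s : ℕ → ℝ≥0 := fun n => 2 ^ n * (2 * β) with hs
  have hs0 : s 0 = 2 * β := by simp [hs]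
  have hsucc : ∀ n, s (n + 1) = 2 * s n := fun n => by simp only [hs]; ring
  have hsmono : ∀ n, s n ≤ s (n + 1) := fun n => by
    rw [hsucc, two_mul]
    exact le_self_add
  have hβs : ∀ n, β < s n := fun n => by
    have h1 : (1 : ℝ≥0) ≤ 2 ^ n := one_le_pow₀ one_le_two
    calc β < 2 * β := by rw [two_mul]; exact lt_add_of_pos_left β hβ
      _ ≤ 2 ^ n * (2 * β) := le_mul_of_one_le_left zero_le h1
  have hPy : ∀ t, P t ≤ t * y t := fun t => by
    have h1 := hP 0 t zero_le
    have h2 := mul_nonneg t.coe_nonneg (hy0 0)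
    nlinarith
  set d : ℕ → ℝ := fun i => y (s (i + 1)) - y (s i) with hd
  have hd0 : ∀ i, 0 ≤ d i := fun i => sub_nonneg.2 (hy (hsmono i))
  have hPs : ∀ n, P (s n) ≤ s 0 * y (s 0) + ∑ i ∈ Finset.range n, s (i + 1) * d i := by
    intro n
    induction n with
    | zero => simpa using hPy (s 0)
    | succ n ih =>
      rw [Finset.sum_range_succ]
      have := hP _ _ (hsmono n)
      simp only [hd] at *
      linarith
  have hpt : ∀ t, ENNReal.ofReal (P t) ≤ 2 * β * ENNReal.ofReal (y t) +
      ∑' i, (Set.Ici (s i)).indicator (fun _ => ENNReal.ofReal (s (i + 1) * d i)) t := by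
    intro t
    have h2β : (2 : ℝ≥0∞) * β = ENNReal.ofReal (s 0) := by
      rw [hs0, ENNReal.ofReal_coe_nnreal]
      push_cast
      rfl
    rw [h2β, ← ENNReal.ofReal_mul (s 0).coe_nonneg]
    rcases lt_or_ge t (s 0) with ht | ht
    · refine le_add_right (ENNReal.ofReal_le_ofReal ((hPy t).trans ?_))
      exact mul_le_mul_of_nonneg_right (by exact_mod_cast ht.le) (hy0 t)
    · obtain ⟨n, hn1, hn2⟩ : ∃ n, s n ≤ t ∧ t < s (n + 1) := by
        have h2 : 0 < 2 * β := by positivity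
        obtain ⟨n, h3, h4⟩ := exists_nat_pow_near (x := t / (2 * β)) (y := 2)
          ((one_le_div h2).2 (hs0 ▸ ht)) one_lt_two
        exact ⟨n, (le_div_iff₀ h2).1 h3, (div_lt_iff₀ h2).1 h4⟩
      have hle : P t ≤ s 0 * y t + ∑ i ∈ Finset.range (n + 1), s (i + 1) * d i := by
        rw [Finset.sum_range_succ]
        have h1 := hP _ _ hn1
        have h2 := hPs n
        have h3 : (t : ℝ) * (y t - y (s n)) ≤ s (n + 1) * d n :=
          mul_le_mul (by exact_mod_cast hn2.le) (sub_le_sub_right (hy hn2.le) _)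
            (sub_nonneg.2 (hy hn1)) (s (n + 1)).coe_nonneg
        have h4 : (s 0 : ℝ) * y (s 0) ≤ s 0 * y t :=
          mul_le_mul_of_nonneg_left (hy ht) (s 0).coe_nonneg
        linarith
      have hterm : ∀ i, 0 ≤ (s (i + 1) : ℝ) * d i := fun i =>
        mul_nonneg (s (i + 1)).coe_nonneg (hd0 i)
      refine (ENNReal.ofReal_le_ofReal hle).trans ?_
      rw [ENNReal.ofReal_add (mul_nonneg (s 0).coe_nonneg (hy0 t))
        (Finset.sum_nonneg fun i _ => hterm i)]
      gcongr
      rw [ENNReal.ofReal_sum_of_nonneg fun i _ => hterm i]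
      refine le_trans (Finset.sum_le_sum fun i hi => ?_) (ENNReal.sum_le_tsum (Finset.range (n + 1)))
      rw [Set.indicator_of_mem]
      exact (monotone_nat_of_le_succ hsmono (Nat.lt_succ_iff.1 (Finset.mem_range.1 hi))).trans hn1
  have hsum : ∑' i, ENNReal.ofReal (d i) ≤ 1 := by
    refine ENNReal.tsum_le_of_sum_range_le fun n => ?_
    rw [← ENNReal.ofReal_sum_of_nonneg fun i _ => hd0 i, Finset.sum_range_sub (fun i => y (s i))]
    refine ENNReal.ofReal_le_one.2 ?_
    linarith [hy1 (s n), hy0 (s 0)]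
  calc ∫⁻ t, ENNReal.ofReal (P t) ∂ν
      ≤ ∫⁻ t, (2 * β * ENNReal.ofReal (y t) + ∑' i, (Set.Ici (s i)).indicator
          (fun _ => ENNReal.ofReal (s (i + 1) * d i)) t) ∂ν := lintegral_mono hpt
    _ = 2 * β * ∫⁻ t, ENNReal.ofReal (y t) ∂ν +
          ∑' i, ENNReal.ofReal (s (i + 1) * d i) * ν (Set.Ici (s i)) := by
        have hym : Measurable fun t => ENNReal.ofReal (y t) := hy.measurable.ennreal_ofReal
        rw [lintegral_add_left (hym.const_mul _), lintegral_const_mul _ hym, lintegral_tsum]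
        · simp_rw [lintegral_indicator_const measurableSet_Ici]
        · exact fun i => (measurable_const.indicator measurableSet_Ici).aemeasurable
    _ ≤ 2 * β * ∫⁻ t, ENNReal.ofReal (y t) ∂ν + ∑' i, ENNReal.ofReal (d i) * (2 * w) := by
        refine add_le_add le_rfl (ENNReal.tsum_le_tsum fun i => ?_)
        rw [hsucc, mul_comm ((2 * s i : ℝ≥0) : ℝ), ENNReal.ofReal_mul (hd0 i),
          ENNReal.ofReal_coe_nnreal, mul_assoc, ENNReal.coe_mul, mul_assoc]
        refine mul_le_mul_right ?_ _
        exact mul_le_mul_right (hw _ (hβs i)) _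
    _ ≤ 2 * β * ∫⁻ t, ENNReal.ofReal (y t) ∂ν + 2 * w := by
        gcongr
        rw [ENNReal.tsum_mul_right]
        exact mul_le_of_le_one_left zero_le hsum

/-! ### The service that an agent uses -/

section Uses

variable {A N : Type*} [Fintype N]

/-- Among the services of `T` targeted at its owner, `e` has the largest value. Ties are broken by
a fixed enumeration of the services, so that at most one service per agent is used. -/
def Uses (owner : N → A) (v : N → ℝ≥0) (T : Finset N) (e : N) : Prop :=
  e ∈ T ∧ ∀ f ∈ T, owner f = owner e →
    toLex (v f, Fintype.equivFin N f) ≤ toLex (v e, Fintype.equivFin N e)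

variable {owner : N → A} {v : N → ℝ≥0} {T : Finset N}

lemma Uses.eq {e f : N} (he : Uses owner v T e) (hf : Uses owner v T f)
    (h : owner e = owner f) : e = f := by
  have h1 := le_antisymm (he.2 f hf.1 h.symm) (hf.2 e he.1 h)
  have h2 := congrArg (fun z => (ofLex z).2) h1
  exact ((Fintype.equivFin N).injective h2).symm

variable [DecidableEq A]

lemma exists_uses {i : A} (h : ∃ e ∈ T, owner e = i) : ∃ e, owner e = i ∧ Uses owner v T e := by
  classical
  obtain ⟨e₀, h1, h2⟩ := h
  obtain ⟨e, he, hmax⟩ := Finset.exists_max_image (T.filter fun e => owner e = i)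
    (fun e => toLex (v e, Fintype.equivFin N e)) ⟨e₀, by simp [h1, h2]⟩
  simp only [Finset.mem_filter] at he hmax
  exact ⟨e, he.2, he.1, fun f hf hfe => hmax f ⟨hf, hfe.trans he.2⟩⟩

lemma Uses.unitDemandValue_eq {e : N} (he : Uses owner v T e) :
    unitDemandValue owner (owner e) v T = v e := by
  refine le_antisymm (Finset.sup_le fun f hf => ?_) ?_
  · simp only [Finset.mem_filter] at hf
    have h1 := he.2 f hf.1 hf.2
    rw [Prod.Lex.toLex_le_toLex] at h1
    rcases h1 with h1 | h1
    exacts [h1.le, h1.1.le]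
  · exact Finset.le_sup (f := v) (by simp [he.1])

omit [Fintype N] in
lemma le_unitDemandValue {e : N} (he : e ∈ T) : v e ≤ unitDemandValue owner (owner e) v T :=
  Finset.le_sup (f := v) (by simp [he])

open Classical in
lemma unitDemandValue_eq_sum (i : A) : (unitDemandValue owner i v T : ℝ) =
    ∑ e with owner e = i, (if Uses owner v T e then 1 else 0) * (v e : ℝ) := by
  by_cases h : ∃ e ∈ T, owner e = i
  · obtain ⟨e, rfl, he⟩ := exists_uses (v := v) h
    rw [he.unitDemandValue_eq, Finset.sum_eq_single e]
    · simp [he]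
    · intro f hf hfe
      rw [if_neg fun hu => hfe (hu.eq he (Finset.mem_filter.1 hf).2), zero_mul]
    · simp
  · push Not at h
    rw [unitDemandValue, Finset.filter_eq_empty_iff.2 (fun _ h1 => h _ h1), Finset.sum_eq_zero]
    · simp
    · intro f hf
      rw [if_neg fun hu => h f hu.1 (Finset.mem_filter.1 hf).2, zero_mul]

open Classical in
lemma unitDemandValue_update_ge [DecidableEq N] (e : N) (t : ℝ≥0) :
    (unitDemandValue owner (owner e) v T : ℝ) + (if Uses owner v T e then 1 else 0) * (t - v e) ≤
      unitDemandValue owner (owner e) (Function.update v e t) T := by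
  by_cases he : Uses owner v T e
  · rw [he.unitDemandValue_eq, if_pos he]
    have := le_unitDemandValue (owner := owner) (v := Function.update v e t) he.1
    rw [Function.update_self] at this
    have h2 : (t : ℝ) ≤ unitDemandValue owner (owner e) (Function.update v e t) T := by
      exact_mod_cast this
    linarith
  · rw [if_neg he, zero_mul, add_zero]
    by_cases h : ∃ f ∈ T, owner f = owner e
    · obtain ⟨f, hfe, hf⟩ := exists_uses (v := v) h
      have hne : f ≠ e := by
        rintro rfl
        exact he hf
      rw [← hfe, hf.unitDemandValue_eq]
      have := le_unitDemandValue (owner := owner) (v := Function.update v e t) hf.1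
      rw [Function.update_of_ne hne] at this
      exact_mod_cast this
    · push Not at h
      rw [unitDemandValue, Finset.filter_eq_empty_iff.2 (fun _ h1 => h _ h1)]
      simp

omit [DecidableEq A] in
lemma measurableSet_uses (owner : N → A) (T : Finset N) (e : N) :
    MeasurableSet {v : N → ℝ≥0 | Uses owner v T e} := by
  simp only [Uses, Prod.Lex.toLex_le_toLex]
  refine measurableSet_setOfPred.2 (Measurable.and measurable_const (Measurable.forall fun f =>
    Measurable.imp measurable_const (Measurable.imp measurable_const (Measurable.or ?_
      (Measurable.and ?_ measurable_const)))))
  · exact measurableSet_setOfPred.1 (measurableSet_lt (measurable_pi_apply f)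
      (measurable_pi_apply e))
  · exact measurableSet_setOfPred.1 (measurableSet_eq_fun (measurable_pi_apply f)
      (measurable_pi_apply e))

end Uses

namespace Mechanism

variable {A N : Type*} [Fintype N] {F : Set (Finset N)}

open Classical in
/-- Probability that `e` is provided and is the service used by its owner, when the values are
`v` and are reported truthfully. -/
noncomputable def useProb (M : Mechanism A F) (owner : N → A) (v : N → ℝ≥0) (e : N) : ℝ :=
  ∑ T : Finset N, (M.alloc v T).toReal * (if Uses owner v T e then 1 else 0)

variable {M : Mechanism A F} {owner : N → A} {v : N → ℝ≥0}

lemma sum_toReal_alloc (M : Mechanism A F) (v : N → ℝ≥0) : ∑ T, (M.alloc v T).toReal = 1 := by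
  rw [← ENNReal.toReal_sum fun T _ => PMF.apply_ne_top _ _, ← tsum_fintype (L := .unconditional _),
    PMF.tsum_coe, ENNReal.toReal_one]

lemma useProb_nonneg (e : N) : 0 ≤ M.useProb owner v e :=
  Finset.sum_nonneg fun T _ => by positivity

open Classical in
lemma sum_mul_useProb_le {a : N → ℝ} {c : ℝ}
    (h : ∀ T ∈ F, ∑ f, a f * (if Uses owner v T f then 1 else 0) ≤ c) :
    ∑ f, a f * M.useProb owner v f ≤ c := by
  calc ∑ f, a f * M.useProb owner v f
      = ∑ T, (M.alloc v T).toReal * ∑ f, a f * (if Uses owner v T f then 1 else 0) := by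
        simp only [useProb, Finset.mul_sum]
        rw [Finset.sum_comm]
        exact Finset.sum_congr rfl fun T _ => Finset.sum_congr rfl fun f _ => by ring
    _ ≤ ∑ T, (M.alloc v T).toReal * c := by
        refine Finset.sum_le_sum fun T _ => ?_
        rcases eq_or_ne (M.alloc v T) 0 with h0 | h0
        · simp [h0]
        · exact mul_le_mul_of_nonneg_left (h T (M.feasible v T h0)) ENNReal.toReal_nonneg
    _ = c := by rw [← Finset.sum_mul, sum_toReal_alloc, one_mul]

lemma sum_useProb_le_one [DecidableEq A] (i : A) :
    ∑ f, (if owner f = i then 1 else 0) * M.useProb owner v f ≤ 1 := by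
  classical
  refine sum_mul_useProb_le fun T _ => ?_
  simp_rw [ite_mul, one_mul, zero_mul, ← ite_and, Finset.sum_boole]
  norm_cast
  refine Finset.card_le_one.2 fun e he f hf => ?_
  simp only [Finset.mem_filter] at he hf
  exact he.2.2.eq hf.2.2 (he.2.1.trans hf.2.1.symm)

lemma useProb_le_one (e : N) : M.useProb owner v e ≤ 1 := by
  classical
  refine le_trans ?_ (sum_useProb_le_one (M := M) (owner := owner) (v := v) (owner e))
  refine le_trans (le_of_eq ?_) (Finset.single_le_sum
    (f := fun f => (if owner f = owner e then 1 else 0) * M.useProb owner v f)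
    (fun f _ => mul_nonneg (by positivity) (useProb_nonneg f)) (Finset.mem_univ e))
  simp

lemma measurable_useProb (M : Mechanism A F) (owner : N → A) (e : N) :
    Measurable fun v => M.useProb owner v e := by
  classical
  refine Finset.measurable_sum _ fun T _ => (M.measurable_alloc T).ennreal_toReal.mul ?_
  exact Measurable.ite (measurableSet_uses owner T e) measurable_const measurable_const

variable [DecidableEq A]

lemma measurable_utility (M : Mechanism A F) (owner : N → A) (i : A) :
    Measurable fun v => M.utility owner i v v := by
  refine Measurable.sub (Finset.measurable_sum _ fun T _ => ?_) (M.measurable_payment i)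
  refine (M.measurable_alloc T).ennreal_toReal.mul (Measurable.coe_nnreal_real ?_)
  unfold unitDemandValue
  induction T.filter fun j => owner j = i using Finset.cons_induction with
  | empty => exact measurable_const
  | cons e s _ ih =>
    simp only [Finset.sup_cons]
    exact (measurable_pi_apply e).sup ih

lemma payment_eq (M : Mechanism A F) (owner : N → A) (i : A) (v : N → ℝ≥0) :
    M.payment v i =
      ∑ e with owner e = i, M.useProb owner v e * v e - M.utility owner i v v := by
  simp only [utility, unitDemandValue_eq_sum, useProb, Finset.mul_sum, Finset.sum_mul]
  rw [Finset.sum_comm]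
  simp only [mul_assoc]
  ring

/-- The probability that `e` is used is a subgradient of the truthful utility of its owner, as a
function of the value of `e`. -/
lemma IsTruthful.utility_update_ge [DecidableEq N] (hM : M.IsTruthful owner) (e : N) (t : ℝ≥0) :
    M.utility owner (owner e) v v + M.useProb owner v e * (t - v e) ≤
      M.utility owner (owner e) (Function.update v e t) (Function.update v e t) := by
  classical
  refine le_trans ?_ (hM.1 (owner e) (Function.update v e t) v fun j hj =>
    (Function.update_of_ne (fun h => hj (congrArg owner h)) _ _).symm)
  simp only [utility, useProb, Finset.sum_mul]
  rw [sub_add_eq_add_sub, ← Finset.sum_add_distrib]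
  refine sub_le_sub_right (Finset.sum_le_sum fun T _ => ?_) _
  rw [mul_assoc, ← mul_add]
  exact mul_le_mul_of_nonneg_left (unitDemandValue_update_ge e t) ENNReal.toReal_nonneg

end Mechanism

/-! ### Upper bound on the revenue of a truthful mechanism -/

/-- The largest excess of the value over the threshold `β` among the services in `s` other
than `e`. -/
noncomputable def rivalExcess {N : Type*} [DecidableEq N] (β : N → ℝ≥0) (s : Finset N) (e : N)
    (v : N → ℝ≥0) : ℝ≥0 :=
  (s.erase e).sup fun f => v f - β f

lemma rivalExcess_update {N : Type*} [DecidableEq N] (β : N → ℝ≥0) (s : Finset N) (e : N)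
    (v : N → ℝ≥0) (t : ℝ≥0) :
    rivalExcess β s e (Function.update v e t) = rivalExcess β s e v :=
  Finset.sup_congr rfl fun f hf => by rw [Function.update_of_ne (Finset.ne_of_mem_erase hf)]

lemma measurable_rivalExcess {N : Type*} [DecidableEq N] (β : N → ℝ≥0) (s : Finset N) (e : N) :
    Measurable (rivalExcess β s e) := by
  unfold rivalExcess
  induction s.erase e using Finset.cons_induction with
  | empty => exact measurable_const
  | cons f s _ ih =>
    simp only [Finset.sup_cons]
    exact ((measurable_pi_apply f).sub measurable_const).sup ih

namespace Mechanism

variable {A N : Type*} [DecidableEq A] [Fintype N] [DecidableEq N] {F : Set (Finset N)}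

/-- The truthful payment for `e`, of value `v e`, when only `e` is allocated, with the probability
with which it is used in `M`, and only for values of at least `m`: the value obtained minus the
increase of the utility from `m` to `v e`. -/
noncomputable def favoritePayment (M : Mechanism A F) (owner : N → A) (e : N) (m : ℝ≥0)
    (v : N → ℝ≥0) : ℝ :=
  if m ≤ v e then M.useProb owner v e * v e - M.utility owner (owner e) v v +
    M.utility owner (owner e) (Function.update v e m) (Function.update v e m) else 0

variable {M : Mechanism A F} {owner : N → A} {v : N → ℝ≥0}

lemma IsTruthful.favoritePayment_nonneg (hM : M.IsTruthful owner) (e : N) (m : ℝ≥0) :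
    0 ≤ M.favoritePayment owner e m v := by
  unfold favoritePayment
  split_ifs with h
  · have h1 := hM.utility_update_ge (v := v) e m
    have h2 := mul_nonneg (M.useProb_nonneg (owner := owner) (v := v) e) m.coe_nonneg
    nlinarith
  · exact le_rfl

/-- What an agent pays is at most the payment for its favorite service, the one exceeding its
threshold most, plus the values of the other services used. The latter are bounded by the
thresholds and the second largest excess. -/
lemma IsTruthful.payment_le (hM : M.IsTruthful owner) (β : N → ℝ≥0) (i : A) (s : Finset N)
    (hs : ∀ e ∈ s, owner e = i) (hzero : ∀ e, owner e = i → e ∉ s → M.useProb owner v e = 0) :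
    M.payment v i ≤ ∑ e ∈ s, (M.favoritePayment owner e (β e + rivalExcess β s e v) v +
      M.useProb owner v e * β e +
      if β e + rivalExcess β s e v ≤ v e then (rivalExcess β s e v : ℝ) else 0) := by
  have hfav : ∀ e ∈ s, 0 ≤ M.favoritePayment owner e (β e + rivalExcess β s e v) v :=
    fun e _ => hM.favoritePayment_nonneg e _
  have hriv : ∀ e ∈ s, 0 ≤ if β e + rivalExcess β s e v ≤ v e then
      (rivalExcess β s e v : ℝ) else 0 := fun e _ => by positivity
  have hpay : M.payment v i =
      ∑ e ∈ s, M.useProb owner v e * v e - M.utility owner i v v := by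
    rw [payment_eq M owner]
    congr 1
    refine (Finset.sum_subset (fun e he => by simp [hs e he]) fun e he hes => ?_).symm
    rw [hzero e (Finset.mem_filter.1 he).2 hes, zero_mul]
  have hu := hM.2 i v
  rw [Finset.sum_add_distrib, Finset.sum_add_distrib, hpay]
  have hU : ∀ e, 0 ≤ M.useProb owner v e := fun e => useProb_nonneg e
  by_cases h : ∃ e ∈ s, β e < v e
  · obtain ⟨e₀, he₀, hv₀⟩ := h
    obtain ⟨e, he, hmax⟩ := Finset.exists_max_image s (fun f => v f - β f) ⟨e₀, he₀⟩
    have hve : β e < v e := tsub_pos_iff_lt.1 ((tsub_pos_of_lt hv₀).trans_le (hmax e₀ he₀))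
    have hT : β e + rivalExcess β s e v ≤ v e := by
      rw [← le_tsub_iff_left hve.le]
      exact Finset.sup_le fun f hf => hmax f (Finset.mem_of_mem_erase hf)
    have h1 : M.useProb owner v e * v e - M.utility owner i v v ≤
        ∑ e ∈ s, M.favoritePayment owner e (β e + rivalExcess β s e v) v := by
      refine le_trans ?_ (Finset.single_le_sum hfav he)
      rw [favoritePayment, if_pos hT, hs e he]
      linarith [hM.2 i (Function.update v e (β e + rivalExcess β s e v))]
    have h2 : (rivalExcess β s e v : ℝ) ≤ ∑ e ∈ s,
        if β e + rivalExcess β s e v ≤ v e then (rivalExcess β s e v : ℝ) else 0 := by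
      refine le_trans ?_ (Finset.single_le_sum hriv he)
      rw [if_pos hT]
    have h3 : ∑ f ∈ s.erase e, M.useProb owner v f * v f ≤
        ∑ f ∈ s, M.useProb owner v f * β f + rivalExcess β s e v := by
      calc ∑ f ∈ s.erase e, M.useProb owner v f * v f
          ≤ ∑ f ∈ s.erase e, M.useProb owner v f * (β f + rivalExcess β s e v) := by
            refine Finset.sum_le_sum fun f hf => mul_le_mul_of_nonneg_left ?_ (hU f)
            have : v f - β f ≤ rivalExcess β s e v := Finset.le_sup (f := fun f => v f - β f) hf
            exact_mod_cast tsub_le_iff_left.1 this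
        _ = ∑ f ∈ s.erase e, M.useProb owner v f * β f +
              (∑ f ∈ s.erase e, M.useProb owner v f) * rivalExcess β s e v := by
            rw [Finset.sum_mul, ← Finset.sum_add_distrib]
            exact Finset.sum_congr rfl fun f _ => by ring
        _ ≤ _ := by
            refine add_le_add (Finset.sum_le_sum_of_subset_of_nonneg (Finset.erase_subset _ _)
              fun f _ _ => mul_nonneg (hU f) (β f).coe_nonneg)
              (mul_le_of_le_one_left (NNReal.coe_nonneg _) ?_)
            refine le_trans ?_ (sum_useProb_le_one (M := M) (owner := owner) (v := v) i)
            simp_rw [ite_mul, one_mul, zero_mul, ← Finset.sum_filter]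
            exact Finset.sum_le_sum_of_subset_of_nonneg
              (fun f hf => by simp [hs f (Finset.mem_of_mem_erase hf)]) fun f _ _ => hU f
    rw [← Finset.add_sum_erase s _ he]
    linarith
  · push Not at h
    have h1 : ∑ e ∈ s, M.useProb owner v e * v e ≤ ∑ e ∈ s, M.useProb owner v e * β e :=
      Finset.sum_le_sum fun e he =>
        mul_le_mul_of_nonneg_left (by exact_mod_cast h e he) (hU e)
    linarith [Finset.sum_nonneg hfav, Finset.sum_nonneg hriv]

lemma measurable_favoritePayment (M : Mechanism A F) (owner : N → A) (e : N)
    {m : (N → ℝ≥0) → ℝ≥0} (hm : Measurable m) :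
    Measurable fun v => M.favoritePayment owner e (m v) v := by
  unfold favoritePayment
  refine Measurable.ite (measurableSet_le hm (measurable_pi_apply e)) ?_ measurable_const
  refine Measurable.add (Measurable.sub ((M.measurable_useProb owner e).mul
    (measurable_pi_apply e).coe_nnreal_real) (M.measurable_utility owner (owner e))) ?_
  refine (M.measurable_utility owner (owner e)).comp (measurable_pi_iff.2 fun j => ?_)
  rcases eq_or_ne j e with rfl | hj
  · simpa using hm
  · simpa [Function.update_of_ne hj] using measurable_pi_apply j

/-- The payment for a favorite service, as a function of its value only, is the payment of a
monotone allocation rule. -/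
lemma IsTruthful.lintegral_favoritePayment_update_le (hM : M.IsTruthful owner) (e : N) (m : ℝ≥0)
    {ν : Measure ℝ≥0} {β : ℝ≥0} (hβ : 0 < β) {w : ℝ≥0∞}
    (hw : ∀ p : ℝ≥0, β < p → p * ν (Set.Ici p) ≤ w) :
    ∫⁻ t, ENNReal.ofReal (M.favoritePayment owner e m (Function.update v e t)) ∂ν ≤
      2 * β * ∫⁻ t, ENNReal.ofReal (M.useProb owner (Function.update v e t) e) ∂ν + 2 * w := by
  set x : ℝ≥0 → ℝ := fun t => M.useProb owner (Function.update v e t) e with hx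
  set h : ℝ≥0 → ℝ := fun t =>
    M.utility owner (owner e) (Function.update v e t) (Function.update v e t) with hh
  have hx0 : ∀ t, 0 ≤ x t := fun t => useProb_nonneg e
  have hsub : ∀ s t : ℝ≥0, h s + x s * (t - s) ≤ h t := by
    intro s t
    have := hM.utility_update_ge (v := Function.update v e s) e t
    simpa using this
  have hxmono : Monotone x := by
    intro s t hst
    rcases hst.eq_or_lt with rfl | hlt
    · exact le_rfl
    have h1 := hsub s t
    have h2 := hsub t s
    have h3 : (0 : ℝ) < t - s := sub_pos.2 (by exact_mod_cast hlt)
    nlinarith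
  set y : ℝ≥0 → ℝ := fun t => if m ≤ t then x t else 0 with hy
  have hyx : ∀ t, y t ≤ x t := fun t => by
    simp only [hy]
    split_ifs
    exacts [le_rfl, hx0 t]
  have hy0 : ∀ t, 0 ≤ y t := fun t => by
    simp only [hy]
    split_ifs
    exacts [hx0 t, le_rfl]
  have hymono : Monotone y := by
    intro s t hst
    by_cases hs : m ≤ s
    · simp only [hy, if_pos hs, if_pos (hs.trans hst)]
      exact hxmono hst
    · simp only [hy, if_neg hs]
      exact hy0 t
  have hP : ∀ t, M.favoritePayment owner e m (Function.update v e t) =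
      if m ≤ t then x t * t - h t + h m else 0 := by
    intro t
    simp [favoritePayment, hx, hh]
  simp_rw [hP]
  refine (lintegral_payment_le hymono hy0 (fun t => (hyx t).trans (useProb_le_one e)) ?_ ?_ hβ
    hw).trans ?_
  · split_ifs with hm
    · obtain rfl : m = 0 := le_antisymm hm zero_le
      simp
    · exact le_rfl
  · intro s t hst
    by_cases hs : m ≤ s
    · simp only [hy, if_pos hs, if_pos (hs.trans hst)]
      nlinarith [hsub s t]
    · by_cases ht : m ≤ t
      · simp only [hy, if_neg hs, if_pos ht]
        have h1 := hsub m t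
        have h2 : (0 : ℝ) ≤ x m * (t - m) :=
          mul_nonneg (hx0 m) (sub_nonneg.2 (by exact_mod_cast ht))
        nlinarith
      · simp [hy, hs, ht]
  · gcongr
    exact hyx _

variable {D : N → Measure ℝ≥0} [∀ j, IsProbabilityMeasure (D j)]

/-- The probability that the service `e` is used. -/
noncomputable def useRate (M : Mechanism A F) (owner : N → A) (D : N → Measure ℝ≥0) (e : N) :
    ℝ≥0 :=
  (∫⁻ v, ENNReal.ofReal (M.useProb owner v e) ∂Measure.pi D).toNNReal

omit [DecidableEq A] [DecidableEq N] in
lemma coe_useRate (M : Mechanism A F) (owner : N → A) (e : N) : (M.useRate owner D e : ℝ≥0∞) =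
    ∫⁻ v, ENNReal.ofReal (M.useProb owner v e) ∂Measure.pi D := by
  refine ENNReal.coe_toNNReal (ne_top_of_le_ne_top ENNReal.one_ne_top ?_)
  refine (lintegral_mono fun v => ENNReal.ofReal_le_one.2 (useProb_le_one e)).trans ?_
  simp

omit [DecidableEq A] [DecidableEq N] in
lemma sum_mul_useRate_le {a : N → ℝ} {c : ℝ}
    (h : ∀ v, ∑ f, a f * M.useProb owner v f ≤ c) :
    ∑ f, a f * (M.useRate owner D f : ℝ) ≤ c := by
  have hint : ∀ f, Integrable (fun v => M.useProb owner v f) (Measure.pi D) := fun f =>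
    Integrable.of_bound (M.measurable_useProb owner f).aestronglyMeasurable 1
      (Filter.Eventually.of_forall fun v => by
        rw [Real.norm_of_nonneg (useProb_nonneg f)]
        exact useProb_le_one f)
  have hrate : ∀ f, (M.useRate owner D f : ℝ) = ∫ v, M.useProb owner v f ∂Measure.pi D := by
    intro f
    rw [integral_eq_lintegral_of_nonneg_ae (Filter.Eventually.of_forall fun v => useProb_nonneg f)
      (M.measurable_useProb owner f).aestronglyMeasurable, ← coe_useRate, ENNReal.coe_toReal]
  simp_rw [hrate, ← integral_const_mul]
  rw [← integral_finsetSum _ fun f _ => (hint f).const_mul _]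
  refine (integral_mono (integrable_finsetSum _ fun f _ => (hint f).const_mul _)
    (integrable_const c) h).trans ?_
  simp

omit [DecidableEq A] [DecidableEq N] in
lemma inRelaxation_useRate (M : Mechanism A F) (owner : N → A) :
    InRelaxation F fun e => (M.useRate owner D e : ℝ) := by
  classical
  intro a c ha hT
  refine sum_mul_useRate_le fun v => sum_mul_useProb_le fun T hTF => le_trans ?_ (hT T hTF)
  simp_rw [mul_ite, mul_one, mul_zero, ← Finset.sum_filter]
  exact Finset.sum_le_sum_of_subset_of_nonneg (fun f hf => (Finset.mem_filter.1 hf).2.1)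
    fun f _ _ => ha f

omit [DecidableEq N] in
lemma sum_useRate_le_one (M : Mechanism A F) (owner : N → A) (i : A) :
    ∑ e, (if owner e = i then M.useRate owner D e else 0) ≤ 1 := by
  have := sum_mul_useRate_le (D := D) fun v => sum_useProb_le_one (M := M) (owner := owner)
    (v := v) i
  rw [← NNReal.coe_le_coe]
  push_cast [apply_ite]
  simpa using this

/-- If no posted price above `w e / q e` raises more than `w e` from the service `e`, where `q e`
is the probability that `e` is used, then truthful mechanisms raise at most `6 * ∑ e, w e`. -/
lemma IsTruthful.lintegral_payment_le [Fintype A] (hM : M.IsTruthful owner) {w : N → ℝ≥0}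
    (hw0 : ∀ e, 0 < w e)
    (hw : ∀ e (p : ℝ≥0), p * min (D e (Set.Ici p)) (M.useRate owner D e) ≤ w e) :
    ∫⁻ v, ENNReal.ofReal (∑ i, M.payment v i) ∂Measure.pi D ≤ 6 * ∑ e, (w e : ℝ≥0∞) := by
  classical
  set q := M.useRate owner D with hq
  set β : N → ℝ≥0 := fun e => w e / q e with hβ
  set s : A → Finset N := fun i => Finset.univ.filter fun e => owner e = i ∧ q e ≠ 0 with hs
  have hβ0 : ∀ e, q e ≠ 0 → 0 < β e := fun e he => div_pos (hw0 e) (pos_iff_ne_zero.2 he)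
  have hβq : ∀ e, q e ≠ 0 → (β e : ℝ≥0∞) * q e = w e := fun e he => by
    rw [← ENNReal.coe_mul, hβ]
    simp only [div_mul_cancel₀ _ he]
  -- Above the threshold `β e`, the sale probability of a price is below `q e`.
  have hprice : ∀ e, q e ≠ 0 → ∀ p : ℝ≥0, β e < p → p * D e (Set.Ici p) ≤ w e := by
    intro e he p hp
    rcases le_total (D e (Set.Ici p)) (q e) with h | h
    · simpa [min_eq_left h] using hw e p
    · have h1 := hw e p
      rw [min_eq_right h] at h1
      have h2 : w e < p * q e := (div_lt_iff₀ (pos_iff_ne_zero.2 he)).1 hp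
      exact absurd (by exact_mod_cast h1 : p * q e ≤ w e) (not_le.2 h2)
  set m : N → (N → ℝ≥0) → ℝ≥0 := fun e v => β e + rivalExcess β (s (owner e)) e v with hm
  have hmm : ∀ e, Measurable (m e) := fun e => (measurable_rivalExcess _ _ _).const_add _
  have hmu : ∀ e v t, m e (Function.update v e t) = m e v := fun e v t => by
    simp only [hm, rivalExcess_update]
  set a : N → (N → ℝ≥0) → ℝ≥0∞ := fun e v =>
    ENNReal.ofReal (M.favoritePayment owner e (m e v) v) with ha
  set b : N → (N → ℝ≥0) → ℝ≥0∞ := fun e v => ENNReal.ofReal (M.useProb owner v e) * β e with hb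
  set c : N → (N → ℝ≥0) → ℝ≥0∞ := fun e v =>
    if m e v ≤ v e then (rivalExcess β (s (owner e)) e v : ℝ≥0∞) else 0 with hc
  have ham : ∀ e, Measurable (a e) := fun e =>
    (M.measurable_favoritePayment owner e (hmm e)).ennreal_ofReal
  have hbm : ∀ e, Measurable (b e) := fun e =>
    ((M.measurable_useProb owner e).ennreal_ofReal).mul_const _
  have hcm : ∀ e, Measurable (c e) := fun e =>
    Measurable.ite (measurableSet_le (hmm e) (measurable_pi_apply e))
      (measurable_rivalExcess _ _ _).coe_nnreal_ennreal measurable_const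
  have hae : ∀ᵐ v ∂Measure.pi D, ∀ e, q e = 0 → M.useProb owner v e = 0 := by
    refine ae_all_iff.2 fun e => ?_
    by_cases he : q e = 0
    · have h1 := coe_useRate (D := D) M owner e
      rw [← hq, he, ENNReal.coe_zero, eq_comm,
        lintegral_eq_zero_iff (M.measurable_useProb owner e).ennreal_ofReal] at h1
      filter_upwards [h1] with v hv _
      exact le_antisymm (ENNReal.ofReal_eq_zero.1 hv) (useProb_nonneg e)
    · exact Filter.Eventually.of_forall fun v h => absurd h he
  have hpt : ∀ᵐ v ∂Measure.pi D, ENNReal.ofReal (∑ i, M.payment v i) ≤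
      ∑ i, ∑ e ∈ s i, (a e v + b e v + c e v) := by
    filter_upwards [hae] with v hv
    have h1 : ∀ i, M.payment v i ≤ ∑ e ∈ s i, (M.favoritePayment owner e (m e v) v +
        M.useProb owner v e * β e +
        if m e v ≤ v e then (rivalExcess β (s (owner e)) e v : ℝ) else 0) := by
      intro i
      refine (hM.payment_le β i (s i) (fun e he => (Finset.mem_filter.1 he).2.1)
        fun e hei hes => hv e ?_).trans (le_of_eq (Finset.sum_congr rfl fun e he => ?_))
      · by_contra hqe
        exact hes (Finset.mem_filter.2 ⟨Finset.mem_univ _, hei, hqe⟩)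
      · simp only [hm, (Finset.mem_filter.1 he).2.1]
    have h2 : ∀ e, 0 ≤ M.favoritePayment owner e (m e v) v := fun e =>
      hM.favoritePayment_nonneg e _
    have h3 : ∀ e, 0 ≤ M.useProb owner v e * β e := fun e =>
      mul_nonneg (useProb_nonneg e) (β e).coe_nonneg
    have h4 : ∀ e, 0 ≤ if m e v ≤ v e then (rivalExcess β (s (owner e)) e v : ℝ) else 0 :=
      fun e => by positivity
    refine (ENNReal.ofReal_le_ofReal (Finset.sum_le_sum fun i _ => h1 i)).trans ?_
    rw [ENNReal.ofReal_sum_of_nonneg fun i _ => Finset.sum_nonneg fun e _ =>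
      add_nonneg (add_nonneg (h2 e) (h3 e)) (h4 e)]
    refine Finset.sum_le_sum fun i _ => ?_
    rw [ENNReal.ofReal_sum_of_nonneg fun e _ => add_nonneg (add_nonneg (h2 e) (h3 e)) (h4 e)]
    refine Finset.sum_le_sum fun e _ => ?_
    rw [ENNReal.ofReal_add (add_nonneg (h2 e) (h3 e)) (h4 e), ENNReal.ofReal_add (h2 e) (h3 e),
      ENNReal.ofReal_mul (useProb_nonneg e), ENNReal.ofReal_coe_nnreal]
    refine add_le_add le_rfl ?_
    simp only [hc]
    split_ifs <;> simp
  have hA : ∀ e, q e ≠ 0 → ∫⁻ v, a e v ∂Measure.pi D ≤ 4 * w e := by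
    intro e he
    rw [lintegral_pi_eq_lintegral_update D (ham e) e]
    calc ∫⁻ v, ∫⁻ t, a e (Function.update v e t) ∂D e ∂Measure.pi D
        ≤ ∫⁻ v, (2 * β e * ∫⁻ t, ENNReal.ofReal (M.useProb owner (Function.update v e t) e) ∂D e
            + 2 * w e) ∂Measure.pi D := by
          refine lintegral_mono fun v => ?_
          simp only [ha, hmu]
          exact hM.lintegral_favoritePayment_update_le e _ (hβ0 e he) (hprice e he)
      _ = 2 * β e * q e + 2 * w e := by
          rw [lintegral_add_right _ measurable_const, lintegral_const_mul' _ _ (by finiteness),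
            ← lintegral_pi_eq_lintegral_update D
              (M.measurable_useProb owner e).ennreal_ofReal e, ← coe_useRate]
          simp [hq]
      _ = 4 * w e := by
          rw [mul_assoc, hβq e he, ← add_mul]
          norm_num
  have hB : ∀ e, q e ≠ 0 → ∫⁻ v, b e v ∂Measure.pi D ≤ w e := by
    intro e he
    rw [lintegral_mul_const _ (M.measurable_useProb owner e).ennreal_ofReal, ← coe_useRate,
      mul_comm, ← hq, hβq e he]
  have hC : ∀ e, q e ≠ 0 → ∫⁻ v, c e v ∂Measure.pi D ≤ w e := by
    intro e he
    rw [lintegral_pi_eq_lintegral_update D (hcm e) e]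
    refine (lintegral_mono fun v => ?_).trans (lintegral_const (w e : ℝ≥0∞)).le |>.trans (by simp)
    simp only [hc, hmu, rivalExcess_update, Function.update_self]
    calc ∫⁻ t, (if m e v ≤ t then (rivalExcess β (s (owner e)) e v : ℝ≥0∞) else 0) ∂D e
        = rivalExcess β (s (owner e)) e v * D e (Set.Ici (m e v)) :=
          lintegral_indicator_const measurableSet_Ici _
      _ ≤ w e := by
          rcases eq_or_ne (rivalExcess β (s (owner e)) e v) 0 with h0 | h0
          · simp [h0]
          · refine le_trans ?_ (hprice e he (m e v) (lt_add_of_pos_right _ (pos_iff_ne_zero.2 h0)))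
            gcongr
            exact le_add_self
  calc ∫⁻ v, ENNReal.ofReal (∑ i, M.payment v i) ∂Measure.pi D
      ≤ ∫⁻ v, ∑ i, ∑ e ∈ s i, (a e v + b e v + c e v) ∂Measure.pi D := lintegral_mono_ae hpt
    _ = ∑ i, ∑ e ∈ s i, (∫⁻ v, a e v ∂Measure.pi D + ∫⁻ v, b e v ∂Measure.pi D +
          ∫⁻ v, c e v ∂Measure.pi D) := by
        have habc : ∀ e, Measurable fun v => a e v + b e v + c e v := fun e =>
          ((ham e).add (hbm e)).add (hcm e)
        rw [lintegral_finsetSum _ fun i _ => Finset.measurable_sum _ fun e _ => habc e]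
        refine Finset.sum_congr rfl fun i _ => ?_
        rw [lintegral_finsetSum _ fun e _ => habc e]
        refine Finset.sum_congr rfl fun e _ => ?_
        rw [lintegral_add_right _ (hcm e), lintegral_add_right _ (hbm e)]
    _ ≤ ∑ i, ∑ e with owner e = i, 6 * (w e : ℝ≥0∞) := by
        refine Finset.sum_le_sum fun i _ => ?_
        refine (Finset.sum_le_sum fun e he => ?_).trans (Finset.sum_le_sum_of_subset
          (fun e he => by simp [(Finset.mem_filter.1 he).2.1]) :
            ∑ e ∈ s i, 6 * (w e : ℝ≥0∞) ≤ _)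
        have he := (Finset.mem_filter.1 he).2.2
        refine (add_le_add (add_le_add (hA e he) (hB e he)) (hC e he)).trans (le_of_eq ?_)
        ring
    _ = 6 * ∑ e, (w e : ℝ≥0∞) := by
        rw [Finset.sum_fiberwise, Finset.mul_sum]

end Mechanism

/-! ### From suprema to a single randomized mechanism -/

/-- Half of a supremum is attained in expectation by some discrete probability measure. If the
supremum is infinite, a mixture with geometric weights has infinite expectation. -/
lemma exists_pmf_iSup_le {X : Type*} [Nonempty X] (f : X → ℝ≥0∞) :
    ∃ μ : PMF X, ⨆ x, f x ≤ 2 * ∑' x, μ x * f x := by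
  classical
  rcases eq_or_ne (⨆ x, f x) ⊤ with htop | htop
  · have hex : ∀ n : ℕ, ∃ x, (2 : ℝ≥0∞) ^ (n + 1) < f x := fun n =>
      lt_iSup_iff.1 (htop ▸ ENNReal.pow_lt_top (by simp))
    choose x hx using hex
    let p : PMF ℕ := ⟨fun n => 2⁻¹ ^ (n + 1), by
      rw [ENNReal.summable.hasSum_iff]
      rw [ENNReal.tsum_geometric_add_one, ENNReal.one_sub_inv_two, inv_inv,
        ENNReal.inv_mul_cancel (by simp) (by simp)]⟩
    refine ⟨p.map x, ?_⟩
    have h1 : ∑' y, (p.map x) y * f y = ∑' n, p n * f (x n) := by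
      simp_rw [PMF.map_apply, ← ENNReal.tsum_mul_right]
      rw [ENNReal.tsum_comm]
      refine tsum_congr fun n => ?_
      rw [tsum_eq_single (x n)]
      · simp
      · intro y hy
        simp [hy]
    have h2 : ∑' n, p n * f (x n) = ⊤ := by
      refine top_le_iff.1 ?_
      calc (⊤ : ℝ≥0∞) = ∑' _ : ℕ, 1 := by simp
        _ ≤ ∑' n, p n * f (x n) := by
          refine ENNReal.tsum_le_tsum fun n => ?_
          calc (1 : ℝ≥0∞) = 2⁻¹ ^ (n + 1) * 2 ^ (n + 1) := by
                rw [← mul_pow, ENNReal.inv_mul_cancel (by simp) (by simp), one_pow]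
            _ ≤ p n * f (x n) := by
                gcongr
                · exact le_rfl
                · exact (hx n).le
    rw [h1, h2]
    simp
  · obtain ⟨x, hx⟩ : ∃ x, (⨆ x, f x) / 2 ≤ f x := by
      rcases eq_or_ne (⨆ x, f x) 0 with h0 | h0
      · exact ⟨Classical.arbitrary X, by simp [h0]⟩
      · obtain ⟨x, hx⟩ := lt_iSup_iff.1 (ENNReal.half_lt_self h0 htop)
        exact ⟨x, hx.le⟩
    refine ⟨PMF.pure x, ?_⟩
    calc ⨆ x, f x = 2 * ((⨆ x, f x) / 2) := (ENNReal.mul_div_cancel (by simp) (by simp)).symm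
      _ ≤ 2 * (PMF.pure x x * f x) := by
          gcongr
          simpa using hx
      _ ≤ _ := by
          gcongr
          exact ENNReal.le_tsum x

lemma sum_iSup_le_of_forall_sum_le {ι X : Type*} [Fintype ι] {f : ι → X → ℝ≥0∞} {B : ℝ≥0∞}
    (h : ∀ p : ι → X, ∑ e, f e (p e) ≤ B) : ∑ e, ⨆ x, f e x ≤ B := by
  classical
  have h1 : ∀ e, ⨆ x, f e x ≤ ⨆ p : ι → X, f e (p e) := by
    intro e
    rcases isEmpty_or_nonempty (ι → X) with hX | ⟨⟨p⟩⟩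
    · have : IsEmpty X := ⟨fun x => hX.false fun _ => x⟩
      simp
    · exact iSup_le fun x => le_iSup_of_le (Function.update p e x) (by simp)
  refine (Finset.sum_le_sum fun e _ => h1 e).trans ?_
  rw [ENNReal.finsetSum_iSup]
  · exact iSup_le h
  · intro p p'
    refine ⟨fun e => if f e (p e) ≤ f e (p' e) then p' e else p e, fun e => ?_⟩
    dsimp only
    split_ifs with he
    exacts [⟨he, le_rfl⟩, ⟨le_rfl, (not_le.1 he).le⟩]

section SupRevenue

variable {A N : Type*} [Fintype A] [DecidableEq A] [Fintype N] [DecidableEq N]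
  {k : ℕ} {F : Set (Finset N)} {owner : N → A} {D : N → Measure ℝ≥0}
  [∀ j, IsProbabilityMeasure (D j)]

lemma Mechanism.IsTruthful.lintegral_payment_le_supRevenue {M : Mechanism A F}
    (hM : M.IsTruthful owner) (hF : IsIntersectionOfConstraints k F) :
    ∫⁻ v, ENNReal.ofReal (∑ i, M.payment v i) ∂Measure.pi D ≤
      6 * (((2 ^ k * (8 * (k + 1)) : ℝ≥0) : ℝ≥0∞) * supRevenue owner F D) := by
  set q := M.useRate owner D with hq
  set B := ((2 ^ k * (8 * (k + 1)) : ℝ≥0) : ℝ≥0∞) * supRevenue owner F D with hB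
  set W : N → ℝ≥0∞ := fun e => ⨆ p : ℝ≥0, (p : ℝ≥0∞) * min (D e (Set.Ici p)) (q e) with hW
  have hsum : ∑ e, W e ≤ B := sum_iSup_le_of_forall_sum_le fun p =>
    sum_price_mul_min_le hF (M.inRelaxation_useRate owner) (M.sum_useRate_le_one owner) p
  rcases eq_or_ne B ⊤ with htop | htop
  · rw [htop]
    simp
  have hWtop : ∀ e, W e ≠ ⊤ := fun e =>
    ne_top_of_le_ne_top htop ((Finset.single_le_sum (fun _ _ => zero_le)
      (Finset.mem_univ e)).trans hsum)
  -- The bounds on the revenue of the single services have to be positive.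
  have hε : ∀ ε : ℝ≥0, 0 < ε → ∫⁻ v, ENNReal.ofReal (∑ i, M.payment v i) ∂Measure.pi D ≤
      6 * B + 6 * (Fintype.card N * ε) := by
    intro ε hε
    refine (hM.lintegral_payment_le (D := D) (w := fun e => (W e).toNNReal + ε)
      (fun e => by positivity) fun e p => ?_).trans ?_
    · rw [ENNReal.coe_add, ENNReal.coe_toNNReal (hWtop e)]
      exact le_add_right (le_iSup (fun p : ℝ≥0 => (p : ℝ≥0∞) * min (D e (Set.Ici p)) (q e)) p)
    · rw [← mul_add]
      gcongr
      simp only [ENNReal.coe_add, ENNReal.coe_toNNReal (hWtop _), Finset.sum_add_distrib,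
        Finset.sum_const, Finset.card_univ, nsmul_eq_mul]
      gcongr
  refine ENNReal.le_of_forall_pos_le_add fun δ hδ _ => ?_
  refine (hε (δ / (6 * (Fintype.card N + 1))) (by positivity)).trans ?_
  gcongr
  have h1 : 6 * (Fintype.card N * (δ / (6 * (Fintype.card N + 1)))) ≤ δ := by
    rw [← mul_assoc, ← mul_div_assoc, div_le_iff₀ (by positivity), mul_comm]
    gcongr
    simp
  exact_mod_cast h1

end SupRevenue

end BMUMD

theorem mainTheorem9 (k : ℕ) :
    ∃ C : ℝ≥0, ∀ (A N : Type*) [Fintype A] [DecidableEq A] [Fintype N] [DecidableEq N]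
      (owner : N → A) (F : Set (Finset N)) (D : N → Measure ℝ≥0) [∀ j, IsProbabilityMeasure (D j)],
      BMUMD.IsIntersectionOfConstraints k F →
        ∃ μ : PMF (BMUMD.PostedPricing F),
          BMUMD.optimalRevenue owner F D ≤
            (((C : ℝ≥0∞) * BMUMD.postedRevenue μ owner D : ℝ≥0∞) : EReal) := by
  refine ⟨6 * (2 ^ k * (8 * (k + 1))) * 2, ?_⟩
  intro A N _ _ _ _ owner F D _ hF
  have : Nonempty (BMUMD.PostedPricing F) := ⟨⟨0, ∅, Set.empty_subset F⟩⟩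
  obtain ⟨μ, hμ⟩ := BMUMD.exists_pmf_iSup_le fun m : BMUMD.PostedPricing F =>
    ∫⁻ v, m.worstCaseRevenue owner v ∂(Measure.pi D)
  refine ⟨μ, iSup₂_le fun M hM => ?_⟩
  -- Dropping the expected negative part can only increase the revenue.
  refine (EReal.sub_le_sub le_rfl (EReal.coe_ennreal_nonneg _)).trans ?_
  rw [sub_zero, EReal.coe_ennreal_le_coe_ennreal_iff]
  refine (hM.lintegral_payment_le_supRevenue hF).trans ?_
  have hC : ((6 * (2 ^ k * (8 * (k + 1))) * 2 : ℝ≥0) : ℝ≥0∞) =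
      6 * (((2 ^ k * (8 * (k + 1)) : ℝ≥0) : ℝ≥0∞) * 2) := by
    push_cast
    ring
  rw [hC, mul_assoc, mul_assoc]
  exact mul_le_mul_right (mul_le_mul_right hμ _) _
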